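/- Let $1\le r<n\le 2r$, $J=I_r\oplus(-I_{n-r})$ and $[x,y]_J=y^*Jx$ on $\mathbb C^n$. For $A\in M_n(\mathbb C)$ put $A^\#=JA^*J$, $\Re^J(A)=\frac12(A+A^\#)$, $\Im^J(A)=\frac1{2i}(A-A^\#)$, $W^J_\pm(A)=\{[Ax,x]_J: x\in\mathbb C^n,\ [x,x]_J=\pm1\}$, and let $W^J(A)=-W^J_-(A)\cup W^J_+(A)$ be the Krein space numerical range. Let $C^J(A)\subset\mathbb C=\mathbb R^2$ be the indefinite Kippenhahn curve, that is, the set of real affine points $x+iy$ of the complex projective algebraic curve with equation $\det(u\,\Re^J(A)+v\,\Im^J(A)+w\,I_n)=0$ in homogeneous line coordinates $(u:v:w)$, where $(u:v:w)$ stands for the line $ux+vy+w=0$. This curve is the union of the duals of the irreducible components of the equation, and the dual of a linear component is a point. For points $f_1,f_2\in\mathbb C$ and lengths $N>0$, $M\ge0$ with $N^2+M^2=|f_1-f_2|^2>0$, the hyperbola with foci $f_1,f_2$, transverse axis of length $N$ and non-transverse axis of length $M$ is $\{w: \big||w-f_1|-|w-f_2|\big|=N\}$ if $M>0$ (the non-degenerate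 case), and the two-point set $\{f_1,f_2\}$ if $M=0$ (the degenerate case). For $S\subseteq W^J(A)$, call a point of $S$ positive if it lies in $W^J_+(A)$ and negative if it lies in $-W^J_-(A)$. The pseudo-convex hull of $S$ (with respect to $A$) is the set obtained from the signed points of $S$ by repeatedly adding the segment joining any two points of the same sign, with that sign, and the half-lines $\{tw_1+(1-t)w_2: t\ge1\}$, with the sign of $w_1$, and $\{tw_1+(1-t)w_2: t\le0\}$, with the sign of $w_2$, for any two points $w_1,w_2$ of opposite signs. **Theorem.** Let $$A=\begin{bmatrix}\alpha I_r & C\\ D&\beta I_{n-r}\end{bmatrix},\qquad \alpha,\beta\in\mathbb C,\ \alpha\ne\beta,$$ where $DC$ is normal and commutes with $C^*C+DD^*$. Let $U$ be a unitary matrix such that $U^*(DC)U$ and $U^*(C^*C+DD^*)U$ are diagonal, with $j$-th diagonal entries $z_j\in\mathbb C$ and $h_j\in\mathbb R$, respectively, $j=1,\dots,n-r$. Put $\Delta_j=(\alpha-\beta)^2+4z_j$, and let $\hat{\mathcal H}_j$ be the hyperbola with foci $\frac12(\alpha+\beta)\pm\frac12\sqrt{\Delta_j}$ and transverse and non-transverse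 axes of lengths $$N_j=\Big(\tfrac12|\Delta_j|+\tfrac12|\alpha-\beta|^2-h_j\Big)^{1/2},\qquad M_j=\Big(\tfrac12|\Delta_j|-\tfrac12|\alpha-\beta|^2+h_j\Big)^{1/2}.$$ The following conditions are equivalent: (a) every $\hat{\mathcal H}_j$, $j=1,\dots,n-r$, is a (possibly degenerate) hyperbola, and $C^J(A)=\hat{\mathcal H}_1\cup\dots\cup\hat{\mathcal H}_{n-r}\cup\{\alpha\}$ if $n<2r$, respectively $C^J(A)=\hat{\mathcal H}_1\cup\dots\cup\hat{\mathcal H}_{n-r}$ if $n=2r$; (b) $|\alpha-\beta|^2-|\Delta_j|\le 2h_j<|\alpha-\beta|^2+|\Delta_j|$ for all $j=1,\dots,n-r$. In this case, $\hat{\mathcal H}_1\cup\dots\cup\hat{\mathcal H}_{n-r}\subseteq W^J(A)$, and $W^J(A)$ is the pseudo-convex hull of $\hat{\mathcal H}_1\cup\dots\cup\hat{\mathcal H}_{n-r}$. Moreover, $\hat{\mathcal H}_j$ is non-degenerate if and only if the left inequality in (b) is strict for this $j$. -/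

import Mathlib

noncomputable section

namespace Krein

open Matrix

/-! The complex vector space `ℂ^n` is indexed by `Fin r ⊕ Fin m`, so that `n = r + m`, and
`J = I_r ⊕ -I_m`. -/

/-- The inertia matrix `J = I_r ⊕ -I_m`. -/
def J (r m : ℕ) : Matrix (Fin r ⊕ Fin m) (Fin r ⊕ Fin m) ℂ :=
  Matrix.fromBlocks 1 0 0 (-1)

/-- The block matrix `[[α I_r, C], [D, β I_m]]`. -/
def blockMatrix {r m : ℕ} (α β : ℂ) (C : Matrix (Fin r) (Fin m) ℂ)
    (D : Matrix (Fin m) (Fin r) ℂ) : Matrix (Fin r ⊕ Fin m) (Fin r ⊕ Fin m) ℂ :=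
  Matrix.fromBlocks (α • 1) C D (β • 1)

/-- The indefinite inner product `[x, y]_J = y^* J x`. -/
def inner {r m : ℕ} (x y : Fin r ⊕ Fin m → ℂ) : ℂ :=
  star y ⬝ᵥ (J r m *ᵥ x)

/-- `W_+^J(A) = {[Ax, x]_J : [x, x]_J = 1}`. -/
def rangePos {r m : ℕ} (A : Matrix (Fin r ⊕ Fin m) (Fin r ⊕ Fin m) ℂ) : Set ℂ :=
  {w | ∃ x : Fin r ⊕ Fin m → ℂ, inner x x = 1 ∧ w = inner (A *ᵥ x) x}

/-- `W_-^J(A) = {[Ax, x]_J : [x, x]_J = -1}`. -/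
def rangeNeg {r m : ℕ} (A : Matrix (Fin r ⊕ Fin m) (Fin r ⊕ Fin m) ℂ) : Set ℂ :=
  {w | ∃ x : Fin r ⊕ Fin m → ℂ, inner x x = -1 ∧ w = inner (A *ᵥ x) x}

/-- The Krein space numerical range `W^J(A) = -W_-^J(A) ∪ W_+^J(A)`. -/
def numericalRange {r m : ℕ} (A : Matrix (Fin r ⊕ Fin m) (Fin r ⊕ Fin m) ℂ) : Set ℂ :=
  {w | -w ∈ rangeNeg A} ∪ rangePos A

/-- The `J`-adjoint `A^# = J A^* J`. -/
def adjoint {r m : ℕ} (A : Matrix (Fin r ⊕ Fin m) (Fin r ⊕ Fin m) ℂ) :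
    Matrix (Fin r ⊕ Fin m) (Fin r ⊕ Fin m) ℂ :=
  J r m * Aᴴ * J r m

/-- `Re^J(A) = (A + A^#) / 2`. -/
def realPart {r m : ℕ} (A : Matrix (Fin r ⊕ Fin m) (Fin r ⊕ Fin m) ℂ) :
    Matrix (Fin r ⊕ Fin m) (Fin r ⊕ Fin m) ℂ :=
  (1 / 2 : ℂ) • (A + adjoint A)

/-- `Im^J(A) = (A - A^#) / (2i)`. -/
def imagPart {r m : ℕ} (A : Matrix (Fin r ⊕ Fin m) (Fin r ⊕ Fin m) ℂ) :
    Matrix (Fin r ⊕ Fin m) (Fin r ⊕ Fin m) ℂ :=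
  (1 / (2 * Complex.I) : ℂ) • (A - adjoint A)

/-- The form `det (u Re^J(A) + v Im^J(A) + w I)` in the line coordinates
`(u, v, w) = (X 0, X 1, X 2)`; the triple `(u, v, w)` stands for the line `u x + v y + w = 0`. -/
def linePolynomial {r m : ℕ} (A : Matrix (Fin r ⊕ Fin m) (Fin r ⊕ Fin m) ℂ) :
    MvPolynomial (Fin 3) ℂ :=
  ((MvPolynomial.X 0 : MvPolynomial (Fin 3) ℂ) • (realPart A).map (MvPolynomial.C (σ := Fin 3)) +
    (MvPolynomial.X 1 : MvPolynomial (Fin 3) ℂ) • (imagPart A).map (MvPolynomial.C (σ := Fin 3)) +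
    (MvPolynomial.X 2 : MvPolynomial (Fin 3) ℂ) • 1).det

/-- The gradient of a polynomial at a point of `ℂ^3`. -/
def gradient (G : MvPolynomial (Fin 3) ℂ) (q : Fin 3 → ℂ) : Fin 3 → ℂ :=
  fun i => MvPolynomial.eval q (MvPolynomial.pderiv i G)

/-- The cone in `ℂ^3` over the curve that is dual to the irreducible projective curve `G = 0`:
the closure of the set of (coordinates of) tangent lines at smooth points of `G = 0`. If `G` is
linear, this is the line spanned by the coefficients of `G`, that is, one projective point. -/
def dualCone (G : MvPolynomial (Fin 3) ℂ) : Set (Fin 3 → ℂ) :=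
  closure {p | ∃ (q : Fin 3 → ℂ) (c : ℂ),
    MvPolynomial.eval q G = 0 ∧ gradient G q ≠ 0 ∧ p = c • gradient G q}

/-- The indefinite Kippenhahn curve `C^J(A)`: the real (affine) points `x + iy` of the algebraic
curve with equation `det (u Re^J(A) + v Im^J(A) + w I) = 0` in line coordinates, which is the union
of the curves dual to the irreducible components of this equation. -/
def kippenhahnCurve {r m : ℕ} (A : Matrix (Fin r ⊕ Fin m) (Fin r ⊕ Fin m) ℂ) : Set ℂ :=
  {w | ∃ G : MvPolynomial (Fin 3) ℂ, Irreducible G ∧ G ∣ linePolynomial A ∧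
    ![(w.re : ℂ), (w.im : ℂ), 1] ∈ dualCone G}

/-- Signed pseudo-convex combinations. Starting from a set `P` of points of positive sign (`true`)
and a set `M` of points of negative sign (`false`), one adds the segments that join points of the
same sign and the two half-lines `{t w₁ + (1 - t) w₂ : t ≤ 0 or t ≥ 1}` for points `w₁, w₂` of
opposite signs; the half-line that starts at a point has the sign of that point (the half-line
`t ≤ 0` is the half-line `t ≥ 1` after exchanging `w₁` and `w₂`). -/
inductive SignedHull (P M : Set ℂ) : Bool → ℂ → Prop
  | pos {w : ℂ} (hw : w ∈ P) : SignedHull P M true w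
  | neg {w : ℂ} (hw : w ∈ M) : SignedHull P M false w
  | segment {s : Bool} {w₁ w₂ : ℂ} {t : ℝ} (h₁ : SignedHull P M s w₁) (h₂ : SignedHull P M s w₂)
      (ht₀ : 0 ≤ t) (ht₁ : t ≤ 1) : SignedHull P M s ((t : ℂ) * w₁ + (1 - (t : ℂ)) * w₂)
  | halfLine {s : Bool} {w₁ w₂ : ℂ} {t : ℝ} (h₁ : SignedHull P M s w₁)
      (h₂ : SignedHull P M (!s) w₂) (ht : 1 ≤ t) :
      SignedHull P M s ((t : ℂ) * w₁ + (1 - (t : ℂ)) * w₂)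

/-- The pseudo-convex hull, with respect to `A`, of a subset `S` of `W^J(A)`: a point
of `S` has positive sign if it is `[Ax, x]_J / [x, x]_J` with `[x, x]_J > 0`, that is, if it lies in
`W_+^J(A)`, and negative sign if this holds with `[x, x]_J < 0`, that is, if it lies
in `-W_-^J(A)`. -/
def pseudoConvexHull {r m : ℕ} (A : Matrix (Fin r ⊕ Fin m) (Fin r ⊕ Fin m) ℂ) (S : Set ℂ) :
    Set ℂ :=
  {w | ∃ s : Bool, SignedHull (S ∩ rangePos A) (S ∩ {w' | -w' ∈ rangeNeg A}) s w}

/-- The hyperbola with foci `f₁, f₂`, transverse axis of length `N` and non-transverse axis of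
length `M`: the points whose distances to the foci differ by `N`. The lengths
satisfy `N² + M² = |f₁ - f₂|²`; there are no points otherwise. If `M = 0`, the
hyperbola degenerates to the two foci. -/
def hyperbola (f₁ f₂ : ℂ) (N M : ℝ) : Set ℂ :=
  {w | N ^ 2 + M ^ 2 = ‖f₁ - f₂‖ ^ 2 ∧ |‖w - f₁‖ - ‖w - f₂‖| = N ∧ (M = 0 → w = f₁ ∨ w = f₂)}

/-- `S` is a (possibly degenerate) hyperbola. -/
def IsHyperbola (S : Set ℂ) : Prop :=
  ∃ (f₁ f₂ : ℂ) (N M : ℝ), f₁ ≠ f₂ ∧ 0 < N ∧ 0 ≤ M ∧ N ^ 2 + M ^ 2 = ‖f₁ - f₂‖ ^ 2 ∧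
    S = hyperbola f₁ f₂ N M

/-- `S` is a non-degenerate hyperbola. -/
def IsNondegenerateHyperbola (S : Set ℂ) : Prop :=
  ∃ (f₁ f₂ : ℂ) (N M : ℝ), f₁ ≠ f₂ ∧ 0 < N ∧ 0 < M ∧ N ^ 2 + M ^ 2 = ‖f₁ - f₂‖ ^ 2 ∧
    S = hyperbola f₁ f₂ N M

/-- `Δ = (α - β)² + 4 z`. -/
def Delta (α β z : ℂ) : ℂ := (α - β) ^ 2 + 4 * z

/-- The focus `(α + β) / 2 + √Δ / 2`. -/
def focusPlus (α β z : ℂ) : ℂ := (1 / 2) * (α + β) + (1 / 2) * Complex.sqrt (Delta α β z)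

/-- The focus `(α + β) / 2 - √Δ / 2`. -/
def focusMinus (α β z : ℂ) : ℂ := (1 / 2) * (α + β) - (1 / 2) * Complex.sqrt (Delta α β z)

/-- `N = (|Δ| / 2 + |α - β|² / 2 - h)^(1/2)`. -/
def transverseAxis (α β z : ℂ) (h : ℝ) : ℝ :=
  Real.sqrt ((1 / 2) * ‖Delta α β z‖ + (1 / 2) * ‖α - β‖ ^ 2 - h)

/-- `M = (|Δ| / 2 - |α - β|² / 2 + h)^(1/2)`. -/
def nonTransverseAxis (α β z : ℂ) (h : ℝ) : ℝ :=
  Real.sqrt ((1 / 2) * ‖Delta α β z‖ - (1 / 2) * ‖α - β‖ ^ 2 + h)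

/-- The hyperbola `Ĥ` with foci `(α + β) / 2 ± √Δ / 2` and axes of lengths `N`, `M`. -/
def hyperbolaHat (α β z : ℂ) (h : ℝ) : Set ℂ :=
  hyperbola (focusPlus α β z) (focusMinus α β z) (transverseAxis α β z h)
    (nonTransverseAxis α β z h)

end Krein

end

/-!
Write `c = (α + β) / 2`, and put every line `2 Re (s (w - c)) + ω = 0` in the coordinates `(s, ω)`.
A functional of this form turns `([A x, x], [x, x])` into a Hermitian form whose diagonal blocks are
the scalars `a = Re (s (α - β)) + ω` and `Re (s (α - β)) - ω`, and whose off-diagonal block is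
`K = s C - conj s D^*`. The commutation hypotheses say that one unitary `U` diagonalizes `K^* K` for
every `s`; the eigenvalues are `gramValue`.

*The curve.* A Schur complement gives the line polynomial as a power of the linear form of `α`
times quadratic factors `ω² - tangentForm s` (`linePolynomial_blockMatrix`). The components of the
curve are the duals of the irreducible factors: a point for a linear factor, the adjugate conic for
a smooth quadric (`mem_dualCone_quadricForm`), which is the hyperbola by `mem_hyperbolaHat_iff`. If
the non-transverse axis vanishes, the quadric splits into the pencils through the two foci. That the
sets `hyperbolaHat` are hyperbolas only under the coefficient condition follows from
connectedness: a hyperbola is not connected, while the sets for a transverse axis of length `0`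
are.

*The numerical range.* The pairs `([A x, x], [x, x])` form a convex cone (`add_mem_kreinCone`, a
Toeplitz-Hausdorff theorem), so the numerical range contains the pseudo-convex hull of its signed
points. A point of the hyperbola with tangent coordinate `s` is the value of an explicit vector in
the kernel of the Hermitian form of its tangent (`blockValue_kernel`), and its sign is that of
`Re (s (α - β))`. For the converse (`blockValue_mem_hullCone`), the cones need not be closed, and a
value outside the cone of the hull is separated from it properly but only weakly. Reversed
Cauchy-Schwarz duality on each hyperbola (`tangentForm_ge_of_forall_le`) shows that the separating
functional has a positive semidefinite Hermitian form, so the value comes from a vector in the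
kernel. Such a vector is a sum over eigenvectors `u_j` whose cross terms cancel, and each summand
gives a contact point on a hyperbola, all at the same level. Hence the value lies in the cone after
all.
-/

noncomputable section

namespace Krein

open ComplexConjugate

/-! ### Tangents and contact points of a hyperbola -/

/-- The real quadratic form `2 Re (E s²) - k |s|²`. A complex number `s` with value `1` stands for
the line `2 Re (s ζ) = 1`, and these lines are the tangents of a conic centred at the origin. -/
def tangentForm (E : ℂ) (k : ℝ) (s : ℂ) : ℝ :=
  2 * (E * s ^ 2).re - k * Complex.normSq s

/-- The polar of `s` with respect to `tangentForm E k`: the number `ζ` for which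
`s' ↦ 2 Re (s' ζ)` is the symmetric bilinear form of `tangentForm E k` with one argument `s`. If
`tangentForm E k s = 1`, this is the point of contact of the tangent `s`. -/
def contactPoint (E : ℂ) (k : ℝ) (s : ℂ) : ℂ :=
  E * s - ((k / 2 : ℝ) : ℂ) * conj s

theorem sq_norm_eq (z : ℂ) : ‖z‖ ^ 2 = z.re ^ 2 + z.im ^ 2 := by
  rw [Complex.sq_norm, Complex.normSq_apply]; ring

/-- The focal description of a non-degenerate hyperbola centred at the origin is equivalent to its
Cartesian equation. -/
theorem abs_dist_sub_dist_eq_iff {e ζ : ℂ} {N M : ℝ} (hN : 0 < N) (hM : 0 < M)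
    (hNM : N ^ 2 + M ^ 2 = 4 * ‖e‖ ^ 2) :
    |‖ζ - e‖ - ‖ζ + e‖| = N ↔
      2 * (conj (e ^ 2) * ζ ^ 2).re + (M ^ 2 - N ^ 2) / 2 * ‖ζ‖ ^ 2 = N ^ 2 * M ^ 2 / 4 := by
  have hp := sq_norm_eq (ζ - e)
  have hq := sq_norm_eq (ζ + e)
  have hp0 := norm_nonneg (ζ - e)
  have hq0 := norm_nonneg (ζ + e)
  rw [sq_norm_eq] at hNM ⊢
  have hR : (conj (e ^ 2) * ζ ^ 2).re =
      (e.re ^ 2 - e.im ^ 2) * (ζ.re ^ 2 - ζ.im ^ 2) + 4 * e.re * e.im * ζ.re * ζ.im := by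
    simp [pow_two]; ring
  rw [hR]
  simp only [Complex.sub_re, Complex.sub_im, Complex.add_re, Complex.add_im] at hp hq
  generalize ‖ζ - e‖ = p at *
  generalize ‖ζ + e‖ = q at *
  generalize ζ.re = x at *
  generalize ζ.im = y at *
  generalize e.re = a at *
  generalize e.im = b at *
  have hsum : p ^ 2 + q ^ 2 = 2 * (x ^ 2 + y ^ 2) + 2 * (a ^ 2 + b ^ 2) := by rw [hp, hq]; ring
  have hprod : (p * q) ^ 2 = (x ^ 2 + y ^ 2) ^ 2 + (a ^ 2 + b ^ 2) ^ 2 -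
      2 * ((a ^ 2 - b ^ 2) * (x ^ 2 - y ^ 2) + 4 * a * b * x * y) := by
    rw [mul_pow, hp, hq]; ring
  have hM2 : M ^ 2 = 4 * (a ^ 2 + b ^ 2) - N ^ 2 := by linarith
  constructor
  · intro h
    have h2 : (p - q) ^ 2 = N ^ 2 := by rw [← h, sq_abs]
    have h3 : 2 * (p * q) = 2 * (x ^ 2 + y ^ 2) + 2 * (a ^ 2 + b ^ 2) - N ^ 2 := by
      linear_combination hsum - h2
    have h4 : 4 * (p * q) ^ 2 = (2 * (x ^ 2 + y ^ 2) + 2 * (a ^ 2 + b ^ 2) - N ^ 2) ^ 2 := by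
      rw [← h3]; ring
    rw [hprod] at h4
    rw [hM2]
    linear_combination (-1 / 4) * h4
  · intro h
    have h4 : (2 * (p * q)) ^ 2 = (2 * (x ^ 2 + y ^ 2) + 2 * (a ^ 2 + b ^ 2) - N ^ 2) ^ 2 := by
      rw [hM2] at h
      linear_combination 4 * hprod + (-4) * h
    have hCS : (a ^ 2 - b ^ 2) * (x ^ 2 - y ^ 2) + 4 * a * b * x * y ≤
        (a ^ 2 + b ^ 2) * (x ^ 2 + y ^ 2) := by
      nlinarith [sq_nonneg (a * y - b * x)]
    -- the point lies outside the circle whose diameter is the transverse axis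
    have hZ : N ^ 2 / 4 ≤ x ^ 2 + y ^ 2 := by
      have h5 : M ^ 2 * (N ^ 2 / 4) ≤ M ^ 2 * (x ^ 2 + y ^ 2) := by
        have : N ^ 2 = 4 * (a ^ 2 + b ^ 2) - M ^ 2 := by linarith
        rw [this] at h ⊢
        nlinarith
      exact le_of_mul_le_mul_left h5 (by positivity)
    have hpos : 0 ≤ 2 * (x ^ 2 + y ^ 2) + 2 * (a ^ 2 + b ^ 2) - N ^ 2 := by
      nlinarith [sq_nonneg M]
    have h3 : 2 * (p * q) = 2 * (x ^ 2 + y ^ 2) + 2 * (a ^ 2 + b ^ 2) - N ^ 2 :=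
      (pow_left_inj₀ (by positivity) hpos two_ne_zero).1 h4
    rw [← abs_of_pos hN]
    exact sq_eq_sq_iff_abs_eq_abs _ _ |>.1 (by linear_combination hsum - h3)

/-- The contact point of the tangent with coordinate `s` satisfies the equation of the
dual conic. -/
theorem dual_form_contactPoint (E : ℂ) (k : ℝ) (s : ℂ) :
    2 * (conj E * contactPoint E k s ^ 2).re + k * ‖contactPoint E k s‖ ^ 2 =
      (‖E‖ ^ 2 - k ^ 2 / 4) * tangentForm E k s := by
  rw [sq_norm_eq, sq_norm_eq, tangentForm, contactPoint, Complex.normSq_apply]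
  simp [pow_two]; ring

theorem contactPoint_dual {E : ℂ} {k d : ℝ} (hd : ‖E‖ ^ 2 - k ^ 2 / 4 = d) (hd0 : d ≠ 0) (ζ : ℂ) :
    contactPoint E k ((conj E * ζ + ((k / 2 : ℝ) : ℂ) * conj ζ) / (d : ℂ)) = ζ := by
  have h : (d : ℂ) = E * conj E - ((k / 2 : ℝ) : ℂ) ^ 2 := by
    rw [Complex.mul_conj, Complex.normSq_eq_norm_sq, ← hd]; push_cast; ring
  have hd' : (d : ℂ) ≠ 0 := by exact_mod_cast hd0
  rw [contactPoint, map_div₀, Complex.conj_ofReal, map_add, map_mul, map_mul, Complex.conj_conj,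
    Complex.conj_conj, Complex.conj_ofReal]
  field_simp
  rw [h]; ring

/-- A nondegenerate conic in line coordinates and its dual conic. -/
theorem exists_contactPoint_iff {E : ℂ} {k : ℝ} (hd : ‖E‖ ^ 2 - k ^ 2 / 4 ≠ 0) (ζ : ℂ) :
    (∃ s, tangentForm E k s = 1 ∧ ζ = contactPoint E k s) ↔
      2 * (conj E * ζ ^ 2).re + k * ‖ζ‖ ^ 2 = ‖E‖ ^ 2 - k ^ 2 / 4 := by
  constructor
  · rintro ⟨s, hs, rfl⟩
    rw [dual_form_contactPoint, hs, mul_one]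
  · intro h
    have hc := contactPoint_dual rfl hd ζ
    refine ⟨_, ?_, hc.symm⟩
    rw [← hc, dual_form_contactPoint] at h
    exact mul_left_cancel₀ hd (by rw [h, mul_one])

/-- Pole-polar duality for a hyperbola with centre `c`: its points are the contact points of the
tangents, which have coordinates on the unit level set of a quadratic form. In the degenerate case
`M = 0` the tangents form two pencils and the contact points are the foci. -/
theorem mem_hyperbola_iff {c e w : ℂ} {N M : ℝ} (he : e ≠ 0) (hN : 0 < N) (hM : 0 ≤ M)
    (hNM : N ^ 2 + M ^ 2 = 4 * ‖e‖ ^ 2) :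
    w ∈ hyperbola (c + e) (c - e) N M ↔
      ∃ s, tangentForm (e ^ 2) ((M ^ 2 - N ^ 2) / 2) s = 1 ∧
        w = c + contactPoint (e ^ 2) ((M ^ 2 - N ^ 2) / 2) s := by
  have hdist : ‖(c + e) - (c - e)‖ = 2 * ‖e‖ := by
    rw [show (c + e) - (c - e) = 2 * e by ring, norm_mul]; simp
  have h1 : w - (c + e) = (w - c) - e := by ring
  have h2 : w - (c - e) = (w - c) + e := by ring
  unfold hyperbola
  simp only [Set.mem_ofPred_eq, hdist, h1, h2]
  have hNM' : N ^ 2 + M ^ 2 = (2 * ‖e‖) ^ 2 := by rw [hNM]; ring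
  rcases hM.eq_or_lt with rfl | hM
  · have hNe : N = 2 * ‖e‖ := by
      rw [← pow_left_inj₀ hN.le (by positivity) two_ne_zero, ← hNM']; ring
    have hk : (((0 ^ 2 - N ^ 2) / 2 / 2 : ℝ) : ℂ) = - (e * conj e) := by
      rw [Complex.mul_conj, Complex.normSq_eq_norm_sq, hNe]; push_cast; ring
    have hct : ∀ s, contactPoint (e ^ 2) ((0 ^ 2 - N ^ 2) / 2) s =
        e * ((2 * (e * s).re : ℝ) : ℂ) := by
      intro s
      have := Complex.add_conj (e * s)
      push_cast at this ⊢
      rw [contactPoint, hk, ← this, map_mul]; ring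
    have htf : ∀ s, tangentForm (e ^ 2) ((0 ^ 2 - N ^ 2) / 2) s = (2 * (e * s).re) ^ 2 := by
      intro s
      rw [tangentForm, hNe, mul_pow, sq_norm_eq, Complex.normSq_apply]
      simp [pow_two]; ring
    constructor
    · rintro ⟨-, -, h⟩
      have hsolve : ∀ ε : ℝ, (e * (((ε / 2 : ℝ) : ℂ) / e)).re = ε / 2 := by
        intro ε; rw [mul_div_cancel₀ _ he, Complex.ofReal_re]
      rcases h rfl with h | h
      · refine ⟨((1 / 2 : ℝ) : ℂ) / e, ?_, ?_⟩
        · rw [htf, hsolve]; norm_num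
        · rw [hct, hsolve, h]; norm_num
      · refine ⟨((-1 / 2 : ℝ) : ℂ) / e, ?_, ?_⟩
        · rw [htf, hsolve]; norm_num
        · rw [hct, hsolve, h]; norm_num; ring
    · rintro ⟨s, hs, rfl⟩
      rw [htf] at hs
      rw [hct, add_sub_cancel_left]
      have hs' : 2 * (e * s).re = 1 ∨ 2 * (e * s).re = -1 := by
        rcases mul_eq_zero.1 (show (2 * (e * s).re - 1) * (2 * (e * s).re + 1) = 0 by
          linear_combination hs) with h | h
        · exact Or.inl (by linarith)
        · exact Or.inr (by linarith)
      rcases hs' with hs | hs <;> rw [hs]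
      · refine ⟨hNM', ?_, fun _ => Or.inl (by simp)⟩
        rw [hNe, show e * ((1 : ℝ) : ℂ) - e = 0 by simp,
          show e * ((1 : ℝ) : ℂ) + e = 2 * e by push_cast; ring, norm_mul]
        simp
      · refine ⟨hNM', ?_, fun _ => Or.inr (by simp [sub_eq_add_neg])⟩
        rw [hNe, show e * ((-1 : ℝ) : ℂ) - e = -(2 * e) by push_cast; ring,
          show e * ((-1 : ℝ) : ℂ) + e = 0 by push_cast; ring, norm_neg, norm_mul]
        simp
  · have key := abs_dist_sub_dist_eq_iff (ζ := w - c) hN hM hNM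
    simp only [hNM', hM.ne', false_imp_iff, and_true, true_and]
    rw [key]
    have hd : ‖e ^ 2‖ ^ 2 - ((M ^ 2 - N ^ 2) / 2) ^ 2 / 4 = N ^ 2 * M ^ 2 / 4 := by
      rw [norm_pow]
      linear_combination (-(N ^ 2 + M ^ 2 + 4 * ‖e‖ ^ 2) / 16) * hNM
    have hd0 : N ^ 2 * M ^ 2 / 4 ≠ 0 := by positivity
    rw [← hd, ← exists_contactPoint_iff (by rwa [hd])]
    simp only [sub_eq_iff_eq_add']

/-! ### When the sets of focal points are hyperbolas -/

/-- A hyperbola with a transverse axis of positive length has two components, as the difference of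
the distances to the foci takes exactly two values on it. -/
theorem not_isPreconnected_hyperbola {f₁ f₂ : ℂ} {N M : ℝ} (hf : f₁ ≠ f₂) (hN : 0 < N)
    (hNM : N ^ 2 + M ^ 2 = ‖f₁ - f₂‖ ^ 2) : ¬ IsPreconnected (hyperbola f₁ f₂ N M) := by
  intro hconn
  have hd : 0 < ‖f₁ - f₂‖ := norm_pos_iff.2 (sub_ne_zero.2 hf)
  have hNd : N ≤ ‖f₁ - f₂‖ := by
    refine (pow_le_pow_iff_left₀ hN.le hd.le two_ne_zero).1 ?_
    linarith [sq_nonneg M]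
  -- the two vertices, `ε = 1` being the one near `f₂`
  have hvertex : ∀ ε : ℝ, ε = 1 ∨ ε = -1 → ∃ w ∈ hyperbola f₁ f₂ N M,
      ‖w - f₁‖ - ‖w - f₂‖ = ε * N := by
    intro ε hε
    have h1 : ∀ τ : ℝ, |τ| ≤ 1 / 2 →
        ‖((f₁ + f₂) / 2 + (τ : ℂ) * (f₂ - f₁)) - f₁‖ = (1 / 2 + τ) * ‖f₁ - f₂‖ := by
      intro τ hτ
      rw [show ((f₁ + f₂) / 2 + (τ : ℂ) * (f₂ - f₁)) - f₁ =
        ((-(1 / 2 + τ) : ℝ) : ℂ) * (f₁ - f₂) by push_cast; ring, norm_mul, Complex.norm_real,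
        norm_neg, Real.norm_of_nonneg (by linarith [neg_abs_le τ])]
    have h2 : ∀ τ : ℝ, |τ| ≤ 1 / 2 →
        ‖((f₁ + f₂) / 2 + (τ : ℂ) * (f₂ - f₁)) - f₂‖ = (1 / 2 - τ) * ‖f₁ - f₂‖ := by
      intro τ hτ
      rw [show ((f₁ + f₂) / 2 + (τ : ℂ) * (f₂ - f₁)) - f₂ =
        ((1 / 2 - τ : ℝ) : ℂ) * (f₁ - f₂) by push_cast; ring, norm_mul, Complex.norm_real,
        Real.norm_of_nonneg (by linarith [le_abs_self τ])]
    have hε1 : |ε| = 1 := by rcases hε with rfl | rfl <;> simp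
    have hτ : |ε * (N / (2 * ‖f₁ - f₂‖))| ≤ 1 / 2 := by
      rw [abs_mul, hε1, one_mul, abs_of_nonneg (by positivity), div_le_iff₀ (by positivity)]
      linarith
    have hdiff : (1 / 2 + ε * (N / (2 * ‖f₁ - f₂‖))) * ‖f₁ - f₂‖ -
        (1 / 2 - ε * (N / (2 * ‖f₁ - f₂‖))) * ‖f₁ - f₂‖ = ε * N := by
      field_simp; ring
    refine ⟨_, ⟨hNM, ?_, ?_⟩, by rw [h1 _ hτ, h2 _ hτ, hdiff]⟩
    · rw [h1 _ hτ, h2 _ hτ, hdiff, abs_mul, hε1, one_mul, abs_of_pos hN]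
    · rintro rfl
      have hNd' : N = ‖f₁ - f₂‖ := by
        rw [← pow_left_inj₀ hN.le hd.le two_ne_zero, ← hNM]; ring
      have : ε * (N / (2 * ‖f₁ - f₂‖)) = ε / 2 := by rw [hNd']; field_simp
      rw [this]
      rcases hε with rfl | rfl
      · right; push_cast; ring
      · left; push_cast; ring
  obtain ⟨w₁, hw₁, h₁⟩ := hvertex 1 (Or.inl rfl)
  obtain ⟨w₂, hw₂, h₂⟩ := hvertex (-1) (Or.inr rfl)
  have hcont : ContinuousOn (fun w : ℂ => ‖w - f₁‖ - ‖w - f₂‖) (hyperbola f₁ f₂ N M) := by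
    fun_prop
  obtain ⟨w, hw, hw0⟩ := hconn.intermediate_value hw₂ hw₁ hcont
    (show (0 : ℝ) ∈ Set.Icc _ _ by simp only [h₁, h₂]; constructor <;> linarith)
  have := hw.2.1
  simp only at hw0
  rw [hw0, abs_zero] at this
  exact hN.ne this

/-- For `N = 0` the focal equation describes a perpendicular bisector, a point, or nothing. -/
theorem isPreconnected_hyperbola_zero (f₁ f₂ : ℂ) (M : ℝ) (hM : M = 0 → f₁ = f₂) :
    IsPreconnected (hyperbola f₁ f₂ 0 M) := by
  by_cases hNM : (0 : ℝ) ^ 2 + M ^ 2 = ‖f₁ - f₂‖ ^ 2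
  · by_cases hM0 : M = 0
    · obtain rfl := hM hM0
      have : hyperbola f₁ f₁ 0 M = {f₁} := by
        ext w; simp [hyperbola, hM0]
      rw [this]; exact isPreconnected_singleton
    · have : hyperbola f₁ f₂ 0 M = (AffineSubspace.perpBisector f₁ f₂ : Set ℂ) := by
        ext w
        rw [SetLike.mem_coe, AffineSubspace.mem_perpBisector_iff_dist_eq, dist_eq_norm,
          dist_eq_norm]
        simp [hyperbola, hM0, abs_eq_zero, sub_eq_zero] at hNM ⊢
        simp [hNM]
      rw [this]; exact (AffineSubspace.convex _).isPreconnected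
  · have : hyperbola f₁ f₂ 0 M = ∅ := by
      ext w; simp only [hyperbola, Set.mem_ofPred_eq, hNM, false_and, Set.mem_empty_iff_false]
    rw [this]; exact isPreconnected_empty

theorem complex_sqrt_sq (a : ℂ) : Complex.sqrt a ^ 2 = a := by
  rw [Complex.sqrt]
  exact Complex.cpow_ofNat_inv_pow a 2

/-- The coefficient of the mixed term in the equation of `hyperbolaHat` in line coordinates. -/
def mixedCoeff (α β : ℂ) (h : ℝ) : ℝ := h - ‖α - β‖ ^ 2 / 2

theorem norm_focus_sub (α β z : ℂ) :
    ‖focusPlus α β z - focusMinus α β z‖ ^ 2 = ‖Delta α β z‖ := by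
  rw [show focusPlus α β z - focusMinus α β z = Complex.sqrt (Delta α β z) by
    unfold focusPlus focusMinus; ring, ← norm_pow, complex_sqrt_sq]

theorem transverseAxis_eq (α β z : ℂ) (h : ℝ) :
    transverseAxis α β z h = Real.sqrt (‖Delta α β z‖ / 2 - mixedCoeff α β h) := by
  unfold transverseAxis mixedCoeff; congr 1; ring

theorem nonTransverseAxis_eq (α β z : ℂ) (h : ℝ) :
    nonTransverseAxis α β z h = Real.sqrt (‖Delta α β z‖ / 2 + mixedCoeff α β h) := by
  unfold nonTransverseAxis mixedCoeff; congr 1; ring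

/-- The coefficient condition under which the lengths of both axes are roots of nonnegative numbers
and the transverse axis is not a point. -/
def Admissible (α β z : ℂ) (h : ℝ) : Prop :=
  -(‖Delta α β z‖ / 2) ≤ mixedCoeff α β h ∧ mixedCoeff α β h < ‖Delta α β z‖ / 2

theorem admissible_iff {α β z : ℂ} {h : ℝ} : Admissible α β z h ↔
    ‖α - β‖ ^ 2 - ‖Delta α β z‖ ≤ 2 * h ∧ 2 * h < ‖α - β‖ ^ 2 + ‖Delta α β z‖ := by
  unfold Admissible mixedCoeff
  constructor <;> rintro ⟨h1, h2⟩ <;> constructor <;> linarith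

namespace Admissible

variable {α β z : ℂ} {h : ℝ}

theorem delta_ne_zero (hb : Admissible α β z h) : Delta α β z ≠ 0 := by
  intro h0
  have := hb.1.trans_lt hb.2
  rw [h0] at this
  simp at this

theorem sqrt_ne_zero (hb : Admissible α β z h) : Complex.sqrt (Delta α β z) ≠ 0 := by
  intro h0
  apply hb.delta_ne_zero
  rw [← complex_sqrt_sq (Delta α β z), h0]; simp

theorem focus_ne (hb : Admissible α β z h) : focusPlus α β z ≠ focusMinus α β z := by
  intro h0
  have := norm_focus_sub α β z
  rw [h0] at this
  simp only [sub_self, norm_zero] at this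
  exact hb.delta_ne_zero (norm_eq_zero.1 (by rw [← this]; simp))

theorem transverseAxis_sq (hb : Admissible α β z h) :
    transverseAxis α β z h ^ 2 = ‖Delta α β z‖ / 2 - mixedCoeff α β h := by
  rw [transverseAxis_eq, Real.sq_sqrt (by linarith [hb.2])]

theorem nonTransverseAxis_sq (hb : Admissible α β z h) :
    nonTransverseAxis α β z h ^ 2 = ‖Delta α β z‖ / 2 + mixedCoeff α β h := by
  rw [nonTransverseAxis_eq, Real.sq_sqrt (by linarith [hb.1])]

theorem transverseAxis_pos (hb : Admissible α β z h) : 0 < transverseAxis α β z h := by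
  rw [transverseAxis_eq]; exact Real.sqrt_pos.2 (by linarith [hb.2])

theorem axes_sq_add (hb : Admissible α β z h) :
    transverseAxis α β z h ^ 2 + nonTransverseAxis α β z h ^ 2 =
      ‖focusPlus α β z - focusMinus α β z‖ ^ 2 := by
  rw [hb.transverseAxis_sq, hb.nonTransverseAxis_sq, norm_focus_sub]; ring

theorem isHyperbola (hb : Admissible α β z h) : IsHyperbola (hyperbolaHat α β z h) :=
  ⟨_, _, _, _, hb.focus_ne, hb.transverseAxis_pos, Real.sqrt_nonneg _, hb.axes_sq_add, rfl⟩

theorem mem_hyperbolaHat_iff (hb : Admissible α β z h) {w : ℂ} :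
    w ∈ hyperbolaHat α β z h ↔
      ∃ s, tangentForm (Delta α β z / 4) (mixedCoeff α β h) s = 1 ∧
        w = (α + β) / 2 + contactPoint (Delta α β z / 4) (mixedCoeff α β h) s := by
  have h1 : focusPlus α β z = (α + β) / 2 + Complex.sqrt (Delta α β z) / 2 := by
    unfold focusPlus; ring
  have h2 : focusMinus α β z = (α + β) / 2 - Complex.sqrt (Delta α β z) / 2 := by
    unfold focusMinus; ring
  have hE : (Complex.sqrt (Delta α β z) / 2) ^ 2 = Delta α β z / 4 := by
    rw [div_pow, complex_sqrt_sq]; norm_num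
  have hk : (nonTransverseAxis α β z h ^ 2 - transverseAxis α β z h ^ 2) / 2 =
      mixedCoeff α β h := by
    rw [hb.transverseAxis_sq, hb.nonTransverseAxis_sq]; ring
  rw [hyperbolaHat, h1, h2, mem_hyperbola_iff (div_ne_zero hb.sqrt_ne_zero two_ne_zero)
    hb.transverseAxis_pos (M := nonTransverseAxis α β z h) (Real.sqrt_nonneg _) ?_, hE, hk]
  have := hb.axes_sq_add
  rw [this, norm_focus_sub, ← norm_pow, hE, norm_div]
  norm_num
  ring

end Admissible

/-- The truncation of negative radicands to `0` in the lengths of the axes does no harm: if a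
radicand is negative, the other one exceeds `‖Δ‖` and the set is empty. If `N = 0`, the set is
preconnected, so it is not a hyperbola for any other data either. -/
theorem isHyperbola_hyperbolaHat_iff {α β z : ℂ} {h : ℝ} :
    IsHyperbola (hyperbolaHat α β z h) ↔ Admissible α β z h := by
  refine ⟨fun H => ?_, Admissible.isHyperbola⟩
  obtain ⟨f₁, f₂, N, M, hf, hN, hM, hNM, hS⟩ := H
  have hnot := not_isPreconnected_hyperbola hf hN hNM
  rw [← hS] at hnot
  have hne : (hyperbolaHat α β z h).Nonempty := by
    by_contra h0
    rw [Set.not_nonempty_iff_eq_empty] at h0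
    exact hnot (h0 ▸ isPreconnected_empty)
  obtain ⟨w, hw⟩ := hne
  have hsum := hw.1
  rw [norm_focus_sub, transverseAxis_eq, nonTransverseAxis_eq] at hsum
  have hM' : -(‖Delta α β z‖ / 2) ≤ mixedCoeff α β h := by
    by_contra! hlt
    rw [Real.sqrt_eq_zero_of_nonpos (x := _ + _) (by linarith), Real.sq_sqrt] at hsum <;>
      linarith [norm_nonneg (Delta α β z)]
  have hN' : mixedCoeff α β h ≤ ‖Delta α β z‖ / 2 := by
    by_contra! hlt
    rw [Real.sqrt_eq_zero_of_nonpos (x := _ - _) (by linarith), Real.sq_sqrt] at hsum <;>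
      linarith [norm_nonneg (Delta α β z)]
  refine ⟨hM', lt_of_le_of_ne hN' fun h0 => hnot ?_⟩
  have hN0 : transverseAxis α β z h = 0 := by rw [transverseAxis_eq, h0]; simp
  rw [hyperbolaHat, hN0]
  refine isPreconnected_hyperbola_zero _ _ _ fun hM0 => ?_
  have hΔ := hw.1
  rw [hN0, hM0] at hΔ
  exact sub_eq_zero.1 (norm_eq_zero.1 (pow_eq_zero_iff two_ne_zero |>.1 (by rw [← hΔ]; ring)))

/-- A non-degenerate hyperbola is infinite: it has a point at every height over the transverse
axis. -/
theorem not_hyperbola_subset_pair {f₁ f₂ : ℂ} {N M : ℝ} (hf : f₁ ≠ f₂) (hN : 0 < N) (hM : 0 < M)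
    (hNM : N ^ 2 + M ^ 2 = ‖f₁ - f₂‖ ^ 2) (a b : ℂ) : ¬ hyperbola f₁ f₂ N M ⊆ {a, b} := by
  intro hsub
  obtain ⟨c, e, rfl, rfl⟩ : ∃ c e, f₁ = c + e ∧ f₂ = c - e :=
    ⟨(f₁ + f₂) / 2, (f₁ - f₂) / 2, by ring, by ring⟩
  have he : e ≠ 0 := by rintro rfl; simp at hf
  have hNM' : N ^ 2 + M ^ 2 = 4 * ‖e‖ ^ 2 := by
    rw [hNM, show (c + e) - (c - e) = 2 * e by ring, norm_mul, mul_pow]; norm_num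
  have he2 : 0 < ‖e‖ ^ 2 := by positivity
  -- the family of points, by the value of `M Y`
  have hpt : ∀ y : ℝ, c + e * (((N * Real.sqrt (1 + y ^ 2) / (2 * ‖e‖) : ℝ) : ℂ) +
      ((M * y / (2 * ‖e‖) : ℝ) : ℂ) * Complex.I) ∈ hyperbola (c + e) (c - e) N M := by
    intro y
    set ζ : ℂ := e * (((N * Real.sqrt (1 + y ^ 2) / (2 * ‖e‖) : ℝ) : ℂ) +
      ((M * y / (2 * ‖e‖) : ℝ) : ℂ) * Complex.I) with hζ
    refine ⟨hNM, ?_, fun h0 => absurd h0 hM.ne'⟩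
    rw [show c + ζ - (c + e) = ζ - e by ring, show c + ζ - (c - e) = ζ + e by ring,
      abs_dist_sub_dist_eq_iff hN hM hNM']
    have hen : ‖e‖ ≠ 0 := norm_ne_zero_iff.2 he
    have h1 : (N * Real.sqrt (1 + y ^ 2) / (2 * ‖e‖)) ^ 2 =
        N ^ 2 * (1 + y ^ 2) / (4 * ‖e‖ ^ 2) := by
      rw [div_pow, mul_pow, Real.sq_sqrt (by positivity)]; ring
    have h2 : (M * y / (2 * ‖e‖)) ^ 2 = M ^ 2 * y ^ 2 / (4 * ‖e‖ ^ 2) := by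
      rw [div_pow]; ring
    generalize N * Real.sqrt (1 + y ^ 2) / (2 * ‖e‖) = p at *
    generalize M * y / (2 * ‖e‖) = q at *
    have h3 : conj (e ^ 2) * ζ ^ 2 = (((‖e‖ ^ 2) ^ 2 : ℝ) : ℂ) * ((p : ℂ) + q * Complex.I) ^ 2 := by
      have := Complex.conj_mul' e
      push_cast
      rw [← this, hζ, map_pow]; ring
    have h4 : ‖ζ‖ ^ 2 = ‖e‖ ^ 2 * (p ^ 2 + q ^ 2) := by
      rw [hζ, norm_mul, mul_pow, sq_norm_eq ((p : ℂ) + q * Complex.I)]; simp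
    rw [h3, h4, Complex.re_ofReal_mul]
    have h5 : (((p : ℂ) + q * Complex.I) ^ 2).re = p ^ 2 - q ^ 2 := by simp [pow_two]
    have h6 : 4 * ‖e‖ ^ 2 * p ^ 2 = N ^ 2 * (1 + y ^ 2) := by rw [h1]; field_simp
    have h7 : 4 * ‖e‖ ^ 2 * q ^ 2 = M ^ 2 * y ^ 2 := by rw [h2]; field_simp
    rw [h5]
    linear_combination (M ^ 2 / 4) * h6 - (N ^ 2 / 4) * h7 -
      (‖e‖ ^ 2 / 2) * (p ^ 2 - q ^ 2) * hNM'
  have hinj : Function.Injective fun y : ℝ =>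
      c + e * (((N * Real.sqrt (1 + y ^ 2) / (2 * ‖e‖) : ℝ) : ℂ) +
        ((M * y / (2 * ‖e‖) : ℝ) : ℂ) * Complex.I) := by
    intro y y' hyy
    have him := congrArg Complex.im (mul_left_cancel₀ he (add_left_cancel hyy))
    simp only [Complex.add_im, Complex.ofReal_im, Complex.mul_I_im, Complex.ofReal_re,
      zero_add] at him
    have hen : ‖e‖ ≠ 0 := norm_ne_zero_iff.2 he
    field_simp at him
    exact him
  refine Set.infinite_range_of_injective hinj ((Set.toFinite {a, b}).subset ?_)
  rintro _ ⟨y, rfl⟩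
  exact hsub (hpt y)

theorem isNondegenerateHyperbola_hyperbolaHat_iff {α β z : ℂ} {h : ℝ} (hb : Admissible α β z h) :
    IsNondegenerateHyperbola (hyperbolaHat α β z h) ↔
      ‖α - β‖ ^ 2 - ‖Delta α β z‖ < 2 * h := by
  constructor
  · rintro ⟨f₁, f₂, N, M, hf, hN, hM, hNM, hS⟩
    by_contra hle
    have hM0 : nonTransverseAxis α β z h = 0 := by
      rw [nonTransverseAxis_eq]
      apply Real.sqrt_eq_zero_of_nonpos
      unfold mixedCoeff; linarith
    refine not_hyperbola_subset_pair hf hN hM hNM (focusPlus α β z) (focusMinus α β z) ?_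
    rw [← hS]
    intro w hw
    exact hw.2.2 hM0
  · intro hlt
    refine ⟨_, _, _, _, hb.focus_ne, hb.transverseAxis_pos, ?_, hb.axes_sq_add, rfl⟩
    rw [nonTransverseAxis_eq]
    apply Real.sqrt_pos.2
    unfold mixedCoeff; linarith

/-! ### Factorization of the line polynomial -/

open Matrix

/-- A Schur complement formula in which the scalar block need not be invertible. -/
theorem det_fromBlocks_smul_one {R : Type*} [CommRing R] [IsDomain R] {r m : ℕ} (hmr : m ≤ r)
    {a : R} (ha : a ≠ 0) (b : R) (B : Matrix (Fin r) (Fin m) R) (B' : Matrix (Fin m) (Fin r) R) :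
    (fromBlocks (a • 1) B B' (b • 1)).det = a ^ (r - m) * ((a * b) • 1 - B' * B).det := by
  have h : fromBlocks (a • 1) B B' (b • 1) * fromBlocks 1 (-B) 0 (a • 1) =
      fromBlocks (a • 1) 0 B' ((a * b) • 1 - B' * B) := by
    rw [fromBlocks_multiply]
    congr 1
    · simp
    · simp
    · simp
    · rw [Matrix.mul_neg, smul_mul_smul_comm, mul_comm b a, Matrix.one_mul]; abel
  have hdet := congrArg det h
  rw [det_mul, det_fromBlocks_zero₂₁, det_fromBlocks_zero₁₂, det_one, one_mul, det_smul, det_smul,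
    det_one, mul_one, Fintype.card_fin, det_one, mul_one, Fintype.card_fin] at hdet
  apply mul_right_cancel₀ (pow_ne_zero m ha)
  rw [hdet]
  rw [mul_right_comm, ← pow_add, Nat.sub_add_cancel hmr]

/-- The linear form in line coordinates whose zeros are the lines through `f`. -/
def pointForm (f : ℂ) : MvPolynomial (Fin 3) ℂ :=
  MvPolynomial.C (f.re : ℂ) * MvPolynomial.X 0 + MvPolynomial.C (f.im : ℂ) * MvPolynomial.X 1 +
    MvPolynomial.X 2

/-- The isotropic line coordinate `(u - i v) / 2`, for `ε = -1`, or `(u + i v) / 2`,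
for `ε = 1`. -/
def isotropicForm (ε : ℂ) : MvPolynomial (Fin 3) ℂ :=
  MvPolynomial.C (1 / 2) * MvPolynomial.X 0 +
    MvPolynomial.C (ε * Complex.I / 2) * MvPolynomial.X 1

/-- The quadratic factor of the line polynomial of `blockMatrix` that belongs to an eigenvalue `z`
of `D C` and an eigenvalue `h` of `C^* C + D D^*`. -/
def lineFactor (α β z : ℂ) (h : ℝ) : MvPolynomial (Fin 3) ℂ :=
  pointForm α * pointForm β - isotropicForm (-1) ^ 2 * MvPolynomial.C z -
    isotropicForm 1 ^ 2 * MvPolynomial.C (conj z) +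
    isotropicForm (-1) * isotropicForm 1 * MvPolynomial.C (h : ℂ)

theorem pointForm_eq (f : ℂ) : pointForm f =
    isotropicForm (-1) * MvPolynomial.C f + isotropicForm 1 * MvPolynomial.C (conj f) +
      MvPolynomial.X 2 := by
  have h1 : (f.re : ℂ) = 1 / 2 * f + 1 / 2 * conj f := by
    rw [Complex.re_eq_add_conj]; ring
  have h2 : (f.im : ℂ) = -1 * Complex.I / 2 * f + 1 * Complex.I / 2 * conj f := by
    rw [Complex.im_eq_sub_conj]; field_simp; rw [Complex.I_sq]; ring
  rw [pointForm, isotropicForm, isotropicForm, h1, h2]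
  simp only [map_add, map_mul]
  ring

theorem pointForm_ne_zero (f : ℂ) : pointForm f ≠ 0 := by
  intro h
  have := congrArg (MvPolynomial.eval ![0, 0, 1]) h
  simp [pointForm] at this

/-- The matrix in the definition of `linePolynomial`, in isotropic line coordinates. -/
theorem lineMatrix_eq {r m : ℕ} (α β : ℂ) (C : Matrix (Fin r) (Fin m) ℂ)
    (D : Matrix (Fin m) (Fin r) ℂ) :
    (MvPolynomial.X 0 : MvPolynomial (Fin 3) ℂ) •
        (realPart (blockMatrix α β C D)).map (MvPolynomial.C (σ := Fin 3)) +
      (MvPolynomial.X 1 : MvPolynomial (Fin 3) ℂ) •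
        (imagPart (blockMatrix α β C D)).map (MvPolynomial.C (σ := Fin 3)) +
      (MvPolynomial.X 2 : MvPolynomial (Fin 3) ℂ) • 1 =
    fromBlocks (pointForm α • 1)
      (isotropicForm (-1) • C.map MvPolynomial.C - isotropicForm 1 • Dᴴ.map MvPolynomial.C)
      (isotropicForm (-1) • D.map MvPolynomial.C - isotropicForm 1 • Cᴴ.map MvPolynomial.C)
      (pointForm β • 1) := by
  have hadj : adjoint (blockMatrix α β C D) =
      fromBlocks (conj α • 1) (-Dᴴ) (-Cᴴ) (conj β • 1) := by
    rw [adjoint, J, blockMatrix, fromBlocks_conjTranspose, fromBlocks_multiply,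
      fromBlocks_multiply]
    simp
  have key : ∀ x y : ℂ, (MvPolynomial.X 0 : MvPolynomial (Fin 3) ℂ) *
      MvPolynomial.C (1 / 2 * (x + y)) +
      MvPolynomial.X 1 * MvPolynomial.C (1 / (2 * Complex.I) * (x - y)) =
      isotropicForm (-1) * MvPolynomial.C x + isotropicForm 1 * MvPolynomial.C y := by
    intro x y
    have hI : 1 / (2 * Complex.I) * (x - y) =
        -1 * Complex.I / 2 * x + 1 * Complex.I / 2 * y := by
      field_simp; rw [Complex.I_sq]; ring
    rw [isotropicForm, isotropicForm, hI]
    simp only [map_add, map_mul]; ring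
  rw [realPart, imagPart, hadj, blockMatrix]
  ext i j : 2
  rcases i with i | i <;> rcases j with j | j <;>
    simp only [Matrix.add_apply, Matrix.smul_apply, Matrix.sub_apply, Matrix.map_apply,
      fromBlocks_apply₁₁, fromBlocks_apply₁₂, fromBlocks_apply₂₁, fromBlocks_apply₂₂, smul_eq_mul,
      key, Matrix.neg_apply]
  · by_cases hij : i = j
    · subst hij; simp [pointForm_eq]
    · simp [hij]
  · simp [sub_eq_add_neg]
  · simp [sub_eq_add_neg]
  · by_cases hij : i = j
    · subst hij; simp [pointForm_eq]
    · simp [hij]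

theorem linePolynomial_blockMatrix {r m : ℕ} (hmr : m ≤ r) (α β : ℂ)
    (C : Matrix (Fin r) (Fin m) ℂ) (D : Matrix (Fin m) (Fin r) ℂ)
    (U : Matrix (Fin m) (Fin m) ℂ) (hU : U ∈ Matrix.unitaryGroup (Fin m) ℂ)
    (z : Fin m → ℂ) (h : Fin m → ℝ)
    (hz : Uᴴ * (D * C) * U = Matrix.diagonal z)
    (hh : Uᴴ * (Cᴴ * C + D * Dᴴ) * U = Matrix.diagonal (fun j => (h j : ℂ))) :
    linePolynomial (blockMatrix α β C D) =
      pointForm α ^ (r - m) * ∏ j, lineFactor α β (z j) (h j) := by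
  rw [linePolynomial, lineMatrix_eq, det_fromBlocks_smul_one hmr (pointForm_ne_zero α)]
  congr 1
  set s := isotropicForm (-1)
  set t := isotropicForm 1
  have hUU : Uᴴ * U = 1 := (Matrix.mem_unitaryGroup_iff').1 hU
  have hzc : Uᴴ * (Cᴴ * Dᴴ) * U = Matrix.diagonal fun j => conj (z j) := by
    have := congrArg conjTranspose hz
    rw [conjTranspose_mul, conjTranspose_mul, conjTranspose_mul, conjTranspose_conjTranspose,
      diagonal_conjTranspose] at this
    rw [Matrix.mul_assoc, this]; rfl
  -- conjugation by the constant matrix `U` diagonalizes the Schur complement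
  let φ : Matrix (Fin m) (Fin m) ℂ →+* Matrix (Fin m) (Fin m) (MvPolynomial (Fin 3) ℂ) :=
    (MvPolynomial.C (σ := Fin 3) (R := ℂ)).mapMatrix
  have hφU : φ Uᴴ * φ U = 1 := by rw [← map_mul, hUU, map_one]
  have hconj : ∀ X, (φ Uᴴ * X * φ U).det = X.det := by
    intro X
    rw [det_mul, det_mul, mul_right_comm, ← det_mul, hφU, det_one, one_mul]
  have hexp : (s • D.map (MvPolynomial.C (σ := Fin 3)) - t • Cᴴ.map MvPolynomial.C) *
      (s • C.map (MvPolynomial.C (σ := Fin 3)) - t • Dᴴ.map MvPolynomial.C) =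
      s ^ 2 • φ (D * C) - (s * t) • φ (Cᴴ * C + D * Dᴴ) + t ^ 2 • φ (Cᴴ * Dᴴ) := by
    simp only [φ, map_add, RingHom.mapMatrix_apply, Matrix.map_mul]
    simp only [Matrix.sub_mul, Matrix.mul_sub, Matrix.smul_mul, Matrix.mul_smul]
    module
  rw [← hconj, hexp]
  have hdiag : φ Uᴴ * ((pointForm α * pointForm β) • 1 -
      (s ^ 2 • φ (D * C) - (s * t) • φ (Cᴴ * C + D * Dᴴ) + t ^ 2 • φ (Cᴴ * Dᴴ))) * φ U =
      Matrix.diagonal fun j => lineFactor α β (z j) (h j) := by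
    have e1 : φ Uᴴ * φ (D * C) * φ U = φ (Matrix.diagonal z) := by
      rw [← map_mul, ← map_mul, hz]
    have e2 : φ Uᴴ * φ (Cᴴ * C + D * Dᴴ) * φ U = φ (Matrix.diagonal fun j => (h j : ℂ)) := by
      rw [← map_mul, ← map_mul, hh]
    have e3 : φ Uᴴ * φ (Cᴴ * Dᴴ) * φ U = φ (Matrix.diagonal fun j => conj (z j)) := by
      rw [← map_mul, ← map_mul, hzc]
    simp only [Matrix.mul_sub, Matrix.sub_mul, Matrix.mul_add, Matrix.add_mul, Matrix.mul_smul,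
      Matrix.smul_mul, Matrix.mul_one, hφU, e1, e2, e3]
    ext i j : 2
    by_cases hij : i = j
    · subst hij
      simp [φ, lineFactor, s, t]; ring
    · simp [φ, hij]
  rw [hdiag, det_diagonal]

/-! ### Dual curves of points and conics -/

/-- The real affine points of the curve with equation `P = 0` in line coordinates. -/
def curveOf (P : MvPolynomial (Fin 3) ℂ) : Set ℂ :=
  {w | ∃ G : MvPolynomial (Fin 3) ℂ, Irreducible G ∧ G ∣ P ∧
    ![(w.re : ℂ), (w.im : ℂ), 1] ∈ dualCone G}

theorem kippenhahnCurve_eq_curveOf {r m : ℕ}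
    (A : Matrix (Fin r ⊕ Fin m) (Fin r ⊕ Fin m) ℂ) :
    kippenhahnCurve A = curveOf (linePolynomial A) := rfl

theorem dualCone_subset_of_associated {G H : MvPolynomial (Fin 3) ℂ} (h : Associated G H) :
    dualCone G ⊆ dualCone H := by
  obtain ⟨u, rfl⟩ := h
  obtain ⟨a, ha, hau⟩ := MvPolynomial.isUnit_iff_eq_C_of_isReduced.1 u.isUnit
  have ha0 : a ≠ 0 := ha.ne_zero
  have hgrad : ∀ q, gradient (G * u) q = a • gradient G q := by
    intro q; ext i
    simp [gradient, hau, mul_comm a]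
  apply closure_mono
  rintro p ⟨q, c, hq, hg, rfl⟩
  refine ⟨q, c * a⁻¹, by simp [hq], by rw [hgrad]; exact smul_ne_zero ha0 hg, ?_⟩
  rw [hgrad, smul_smul, mul_assoc, inv_mul_cancel₀ ha0, mul_one]

/-- An irreducible polynomial in a factorial ring is prime, so a union of curves corresponds to the
product of the equations. -/
theorem curveOf_mul (P Q : MvPolynomial (Fin 3) ℂ) :
    curveOf (P * Q) = curveOf P ∪ curveOf Q := by
  ext w
  constructor
  · rintro ⟨G, hG, hdvd, hw⟩
    rcases hG.prime.dvd_or_dvd hdvd with h | h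
    · exact Or.inl ⟨G, hG, h, hw⟩
    · exact Or.inr ⟨G, hG, h, hw⟩
  · rintro (⟨G, hG, hdvd, hw⟩ | ⟨G, hG, hdvd, hw⟩)
    · exact ⟨G, hG, hdvd.mul_right Q, hw⟩
    · exact ⟨G, hG, hdvd.mul_left P, hw⟩

theorem curveOf_one : curveOf 1 = ∅ := by
  ext w
  simp only [curveOf, Set.mem_ofPred_eq, Set.mem_empty_iff_false, iff_false]
  rintro ⟨G, hG, hdvd, -⟩
  exact hG.not_isUnit (isUnit_of_dvd_one hdvd)

theorem curveOf_prod {ι : Type*} (s : Finset ι) (P : ι → MvPolynomial (Fin 3) ℂ) :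
    curveOf (∏ j ∈ s, P j) = ⋃ j ∈ s, curveOf (P j) := by
  classical
  induction s using Finset.induction_on with
  | empty => simp [curveOf_one]
  | insert a s ha ih => rw [Finset.prod_insert ha, curveOf_mul, ih, Finset.set_biUnion_insert]

theorem curveOf_pow (P : MvPolynomial (Fin 3) ℂ) (n : ℕ) :
    curveOf (P ^ n) = {w | 0 < n ∧ w ∈ curveOf P} := by
  induction n with
  | zero => simp [curveOf_one]
  | succ n ih =>
    rw [pow_succ, curveOf_mul, ih]
    ext w
    simp only [Set.mem_union, Set.mem_ofPred_eq, Nat.succ_pos, true_and]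
    tauto

theorem curveOf_of_irreducible {P : MvPolynomial (Fin 3) ℂ} (hP : Irreducible P) :
    curveOf P = {w | ![(w.re : ℂ), (w.im : ℂ), 1] ∈ dualCone P} := by
  ext w
  constructor
  · rintro ⟨G, hG, hdvd, hw⟩
    exact dualCone_subset_of_associated (hG.associated_of_dvd hP hdvd) hw
  · intro hw
    exact ⟨P, hP, dvd_rfl, hw⟩

theorem irreducible_pointForm (f : ℂ) : Irreducible (pointForm f) := by
  have hle : (pointForm f).totalDegree ≤ 1 := by
    unfold pointForm
    refine (MvPolynomial.totalDegree_add _ _).trans (max_le ((MvPolynomial.totalDegree_add _ _).trans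
      (max_le ?_ ?_)) ?_)
    · exact (MvPolynomial.totalDegree_mul _ _).trans (by simp)
    · exact (MvPolynomial.totalDegree_mul _ _).trans (by simp)
    · simp
  have hcoeff : (pointForm f).coeff (Finsupp.single 2 1) = 1 := by
    simp [pointForm, MvPolynomial.coeff_C_mul, MvPolynomial.coeff_X, Finsupp.single_left_inj]
  apply MvPolynomial.irreducible_of_totalDegree_eq_one
  · refine le_antisymm hle ?_
    have := MvPolynomial.le_totalDegree (p := pointForm f) (s := Finsupp.single 2 1)
      (by rw [MvPolynomial.mem_support_iff, hcoeff]; exact one_ne_zero)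
    simpa using this
  · intro x hx
    exact isUnit_of_dvd_one (hcoeff ▸ hx (Finsupp.single 2 1))

theorem gradient_pointForm (f : ℂ) (q : Fin 3 → ℂ) :
    gradient (pointForm f) q = ![(f.re : ℂ), (f.im : ℂ), 1] := by
  ext i
  fin_cases i <;> simp [gradient, pointForm, MvPolynomial.pderiv_X]

theorem curveOf_pointForm (f : ℂ) : curveOf (pointForm f) = {f} := by
  rw [curveOf_of_irreducible (irreducible_pointForm f)]
  ext w
  rw [Set.mem_ofPred_eq, Set.mem_singleton_iff]
  constructor
  · intro hw
    have hsub : dualCone (pointForm f) ⊆ {p | p 0 = f.re * p 2 ∧ p 1 = f.im * p 2} := by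
      apply closure_minimal
      · rintro p ⟨q, c, -, -, rfl⟩
        rw [gradient_pointForm]
        simp [mul_comm]
      · exact (isClosed_eq (by fun_prop) (by fun_prop)).inter
          (isClosed_eq (by fun_prop) (by fun_prop))
    have := hsub hw
    simp at this
    exact Complex.ext this.1 this.2
  · rintro rfl
    refine subset_closure ⟨0, 1, by simp [pointForm], ?_, by rw [gradient_pointForm, one_smul]⟩
    rw [gradient_pointForm]
    intro h
    simpa using congrFun h 2

/-- The quadratic form with matrix `S`, as a polynomial. -/
def quadricForm (S : Matrix (Fin 3) (Fin 3) ℂ) : MvPolynomial (Fin 3) ℂ :=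
  ∑ i, ∑ j, MvPolynomial.C (S i j) * (MvPolynomial.X i * MvPolynomial.X j)

theorem eval_quadricForm (S : Matrix (Fin 3) (Fin 3) ℂ) (q : Fin 3 → ℂ) :
    MvPolynomial.eval q (quadricForm S) = q ⬝ᵥ (S *ᵥ q) := by
  simp [quadricForm, dotProduct, mulVec, Fin.sum_univ_three]
  ring

theorem gradient_quadricForm {S : Matrix (Fin 3) (Fin 3) ℂ} (hS : S.IsSymm) (q : Fin 3 → ℂ) :
    gradient (quadricForm S) q = (2 : ℂ) • (S *ᵥ q) := by
  have h01 := hS.apply 0 1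
  have h02 := hS.apply 0 2
  have h12 := hS.apply 1 2
  ext i
  fin_cases i <;>
    simp [gradient, quadricForm, dotProduct, mulVec, Fin.sum_univ_three, MvPolynomial.pderiv_X,
      h01, h02, h12] <;> ring

/-- The dual of a smooth conic is the conic of the adjugate matrix. The point `0` is excluded, as it
does not represent a projective point. -/
theorem mem_dualCone_quadricForm {S : Matrix (Fin 3) (Fin 3) ℂ} (hS : S.IsSymm) (hdet : S.det ≠ 0)
    {p : Fin 3 → ℂ} (hp : p ≠ 0) :
    p ∈ dualCone (quadricForm S) ↔ p ⬝ᵥ (S.adjugate *ᵥ p) = 0 := by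
  constructor
  · intro hmem
    have hsub : dualCone (quadricForm S) ⊆ {p | p ⬝ᵥ (S.adjugate *ᵥ p) = 0} := by
      apply closure_minimal
      · rintro p ⟨q, c, hq, -, rfl⟩
        rw [eval_quadricForm] at hq
        rw [gradient_quadricForm hS, Set.mem_ofPred_eq, smul_smul, mulVec_smul, mulVec_mulVec,
          adjugate_mul, smul_mulVec, one_mulVec, dotProduct_smul, smul_dotProduct,
          dotProduct_smul, dotProduct_comm, hq]
        simp
      · exact isClosed_eq (by unfold dotProduct mulVec; fun_prop) continuous_const
    exact hsub hmem
  · intro h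
    have hSq : S *ᵥ (S.adjugate *ᵥ p) = S.det • p := by
      rw [mulVec_mulVec, mul_adjugate, smul_mulVec, one_mulVec]
    refine subset_closure ⟨S.adjugate *ᵥ p, (2 * S.det)⁻¹, ?_, ?_, ?_⟩
    · rw [eval_quadricForm, hSq, dotProduct_smul, dotProduct_comm, h, smul_zero]
    · rw [gradient_quadricForm hS, hSq, smul_smul]
      exact smul_ne_zero (mul_ne_zero two_ne_zero hdet) hp
    · rw [gradient_quadricForm hS, hSq, smul_smul, smul_smul, mul_assoc, inv_mul_cancel₀
        (mul_ne_zero two_ne_zero hdet), one_smul]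

theorem eval_of_totalDegree_le_one {G : MvPolynomial (Fin 3) ℂ} (hG : G.totalDegree ≤ 1) :
    ∃ (a : ℂ) (g : Fin 3 → ℂ), ∀ q, MvPolynomial.eval q G = a + g ⬝ᵥ q := by
  refine ⟨G.coeff 0, fun i => G.coeff (Finsupp.single i 1), fun q => ?_⟩
  have : G = MvPolynomial.C (G.coeff 0) +
      ∑ i, MvPolynomial.C (G.coeff (Finsupp.single i 1)) * MvPolynomial.X i := by
    ext d
    simp only [MvPolynomial.coeff_add, MvPolynomial.coeff_C, MvPolynomial.coeff_sum,
      MvPolynomial.coeff_C_mul, MvPolynomial.coeff_X]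
    by_cases hd0 : d = 0
    · subst hd0; simp
    by_cases hd1 : ∃ i, d = Finsupp.single i 1
    · obtain ⟨i, rfl⟩ := hd1
      rw [if_neg (by simp [eq_comm]), zero_add, Finset.sum_eq_single i]
      · simp
      · intro j _ hji
        rw [if_neg (by simpa [Finsupp.single_left_inj] using hji), mul_zero]
      · simp
    · push Not at hd1
      rw [if_neg (Ne.symm hd0), zero_add, Finset.sum_eq_zero fun i _ => by
        rw [if_neg (hd1 i).symm, mul_zero]]
      apply MvPolynomial.coeff_eq_zero_of_totalDegree_lt
      by_contra! hle
      have hle' : d.degree ≤ 1 := hle.trans hG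
      rcases Nat.le_one_iff_eq_zero_or_eq_one.1 hle' with h | h
      · exact hd0 ((Finsupp.degree_eq_zero_iff d).1 h)
      · rw [Finsupp.degree_eq_sum, Fin.sum_univ_three] at h
        have hne : ∃ i, d i ≠ 0 := by
          by_contra! h0
          simp [h0] at h
        obtain ⟨i, hi⟩ := hne
        refine hd1 i (Finsupp.ext fun j => ?_)
        fin_cases i <;> fin_cases j <;> simp at hi ⊢ <;> omega
  conv_lhs => rw [this]
  simp [dotProduct]

theorem irreducible_quadricForm {S : Matrix (Fin 3) (Fin 3) ℂ} (hS : S.IsSymm) (hdet : S.det ≠ 0) :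
    Irreducible (quadricForm S) := by
  have hdeg : (quadricForm S).totalDegree ≤ 2 := by
    refine MvPolynomial.totalDegree_finsetSum_le fun i _ =>
      MvPolynomial.totalDegree_finsetSum_le fun j _ => ?_
    refine (MvPolynomial.totalDegree_mul _ _).trans ?_
    have := MvPolynomial.totalDegree_mul (MvPolynomial.X i : MvPolynomial (Fin 3) ℂ)
      (MvPolynomial.X j)
    simp only [MvPolynomial.totalDegree_X, MvPolynomial.totalDegree_C] at this ⊢
    omega
  -- a product of two affine functions has a quadratic part of rank at most two
  have hnot : ∀ G H : MvPolynomial (Fin 3) ℂ, quadricForm S = G * H → G.totalDegree ≤ 1 →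
      H.totalDegree ≤ 1 → False := by
    intro G H hGH hG hH
    obtain ⟨a, g, hg⟩ := eval_of_totalDegree_le_one hG
    obtain ⟨b, h, hh⟩ := eval_of_totalDegree_le_one hH
    have hq : ∀ q, q ⬝ᵥ (S *ᵥ q) = (a + g ⬝ᵥ q) * (b + h ⬝ᵥ q) := by
      intro q
      rw [← eval_quadricForm, hGH, map_mul, hg, hh]
    have hev : ∀ x y z : ℂ, x * (S 0 0 * x + S 0 1 * y + S 0 2 * z) +
        y * (S 0 1 * x + S 1 1 * y + S 1 2 * z) + z * (S 0 2 * x + S 1 2 * y + S 2 2 * z) =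
        (a + (g 0 * x + g 1 * y + g 2 * z)) * (b + (h 0 * x + h 1 * y + h 2 * z)) := by
      intro x y z
      have := hq ![x, y, z]
      simpa [dotProduct, mulVec, Fin.sum_univ_three, hS.apply 0 1, hS.apply 0 2, hS.apply 1 2]
        using this
    have h0 := hev 0 0 0
    have e1 := hev 1 0 0
    have e1' := hev (-1) 0 0
    have e2 := hev 0 1 0
    have e2' := hev 0 (-1) 0
    have e3 := hev 0 0 1
    have e3' := hev 0 0 (-1)
    have e12 := hev 1 1 0
    have e12' := hev (-1) (-1) 0
    have e13 := hev 1 0 1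
    have e13' := hev (-1) 0 (-1)
    have e23 := hev 0 1 1
    have e23' := hev 0 (-1) (-1)
    have s00 : S 0 0 = g 0 * h 0 := by linear_combination (e1 + e1') / 2 - h0
    have s11 : S 1 1 = g 1 * h 1 := by linear_combination (e2 + e2') / 2 - h0
    have s22 : S 2 2 = g 2 * h 2 := by linear_combination (e3 + e3') / 2 - h0
    have s01 : S 0 1 = (g 0 * h 1 + g 1 * h 0) / 2 := by
      linear_combination (e12 + e12') / 4 - h0 / 2 - s00 / 2 - s11 / 2
    have s02 : S 0 2 = (g 0 * h 2 + g 2 * h 0) / 2 := by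
      linear_combination (e13 + e13') / 4 - h0 / 2 - s00 / 2 - s22 / 2
    have s12 : S 1 2 = (g 1 * h 2 + g 2 * h 1) / 2 := by
      linear_combination (e23 + e23') / 4 - h0 / 2 - s11 / 2 - s22 / 2
    apply hdet
    rw [det_fin_three, hS.apply 0 1, hS.apply 0 2, hS.apply 1 2, s00, s11, s22, s01, s02, s12]
    ring
  refine ⟨fun hu => ?_, fun G H hGH => ?_⟩
  · obtain ⟨a, ha, hau⟩ := MvPolynomial.isUnit_iff_eq_C_of_isReduced.1 hu
    refine hnot (quadricForm S) 1 (by rw [mul_one]) ?_ (by simp)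
    rw [hau]; simp
  · by_contra! hnu
    have hne : quadricForm S ≠ 0 := by
      intro h0
      exact hnot 0 0 (by rw [h0, mul_zero]) (by simp) (by simp)
    have hG0 : G ≠ 0 := by rintro rfl; exact hne (by rw [hGH, zero_mul])
    have hH0 : H ≠ 0 := by rintro rfl; exact hne (by rw [hGH, mul_zero])
    have hpos : ∀ P : MvPolynomial (Fin 3) ℂ, P ≠ 0 → ¬ IsUnit P → 1 ≤ P.totalDegree := by
      intro P hP0 hP
      by_contra! hlt
      have hC := MvPolynomial.totalDegree_eq_zero_iff_eq_C.1 (Nat.lt_one_iff.1 hlt)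
      refine hP ?_
      rw [hC] at hP0 ⊢
      exact (isUnit_iff_ne_zero.2 fun h0 => hP0 (by rw [h0, map_zero])).map MvPolynomial.C
    have hsum := MvPolynomial.totalDegree_mul_of_isDomain hG0 hH0
    rw [← hGH] at hsum
    have h1 := hpos G hG0 hnu.1
    have h2 := hpos H hH0 hnu.2
    exact hnot G H hGH (by omega) (by omega)

/-! ### The Kippenhahn curve -/

/-- The matrix, in the line coordinates `(u, v, w)`, of the dual of the conic with centre `c` whose
tangents are described by the form `tangentForm E k`. -/
def conicMatrix (c E : ℂ) (k : ℝ) : Matrix (Fin 3) (Fin 3) ℂ :=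
  !![(c.re : ℂ) ^ 2 - E.re / 2 + k / 4, c.re * c.im - E.im / 2, c.re;
    c.re * c.im - E.im / 2, (c.im : ℂ) ^ 2 + E.re / 2 + k / 4, c.im;
    c.re, c.im, 1]

theorem conicMatrix_isSymm (c E : ℂ) (k : ℝ) : (conicMatrix c E k).IsSymm := by
  ext i j
  fin_cases i <;> fin_cases j <;> simp [conicMatrix]

theorem det_conicMatrix (c E : ℂ) (k : ℝ) :
    (conicMatrix c E k).det = ((-(‖E‖ ^ 2 - k ^ 2 / 4) / 4 : ℝ) : ℂ) := by
  rw [sq_norm_eq, det_fin_three]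
  simp [conicMatrix]
  ring

theorem dual_conicMatrix (c E w : ℂ) (k : ℝ) :
    ![(w.re : ℂ), (w.im : ℂ), 1] ⬝ᵥ
        ((conicMatrix c E k).adjugate *ᵥ ![(w.re : ℂ), (w.im : ℂ), 1]) =
      (((2 * (conj E * (w - c) ^ 2).re + k * ‖w - c‖ ^ 2 - (‖E‖ ^ 2 - k ^ 2 / 4)) / 4 : ℝ) : ℂ) := by
  rw [sq_norm_eq, sq_norm_eq, adjugate_fin_three]
  simp [conicMatrix, dotProduct, mulVec, Fin.sum_univ_three, pow_two]
  ring

theorem lineFactor_eq_quadricForm (α β z : ℂ) (h : ℝ) :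
    lineFactor α β z h =
      quadricForm (conicMatrix ((α + β) / 2) (Delta α β z / 4) (mixedCoeff α β h)) := by
  apply MvPolynomial.funext
  intro q
  rw [lineFactor, mixedCoeff, sq_norm_eq]
  simp only [map_add, map_sub, map_mul, map_pow, MvPolynomial.eval_C, eval_quadricForm,
    isotropicForm, pointForm, MvPolynomial.eval_X]
  obtain ⟨z1, z2⟩ := z
  have hz : (⟨z1, z2⟩ : ℂ) = z1 + z2 * Complex.I := Complex.mk_eq_add_mul_I z1 z2
  have hzc : conj (⟨z1, z2⟩ : ℂ) = z1 - z2 * Complex.I := by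
    rw [hz]; simp [sub_eq_add_neg]
  have hE1 : (Delta α β ⟨z1, z2⟩ / 4).re =
      ((α.re - β.re) ^ 2 - (α.im - β.im) ^ 2) / 4 + z1 := by
    simp [Delta, pow_two]; ring
  have hE2 : (Delta α β ⟨z1, z2⟩ / 4).im = (α.re - β.re) * (α.im - β.im) / 2 + z2 := by
    simp [Delta, pow_two]; ring
  have hc1 : ((α + β) / 2).re = (α.re + β.re) / 2 := by simp
  have hc2 : ((α + β) / 2).im = (α.im + β.im) / 2 := by simp
  rw [conicMatrix, hE1, hE2, hc1, hc2, hzc, hz]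
  simp only [dotProduct, mulVec, Fin.sum_univ_three]
  simp
  ring_nf
  simp only [Complex.I_sq]
  ring

/-- In the degenerate case the quadratic factor splits into the pencils of lines through the
foci. -/
theorem lineFactor_eq_mul {α β z : ℂ} {h : ℝ} (hk : mixedCoeff α β h = -(‖Delta α β z‖ / 2)) :
    lineFactor α β z h = pointForm (focusPlus α β z) * pointForm (focusMinus α β z) := by
  set e := Complex.sqrt (Delta α β z) / 2 with he
  have hE : Delta α β z / 4 = e ^ 2 := by rw [he, div_pow, complex_sqrt_sq]; norm_num
  have h1 : focusPlus α β z = (α + β) / 2 + e := by unfold focusPlus; rw [he]; ring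
  have h2 : focusMinus α β z = (α + β) / 2 - e := by unfold focusMinus; rw [he]; ring
  have hk' : mixedCoeff α β h = -2 * (e.re ^ 2 + e.im ^ 2) := by
    have : ‖Delta α β z / 4‖ = ‖e‖ ^ 2 := by rw [hE, norm_pow]
    rw [norm_div, sq_norm_eq, show ‖(4 : ℂ)‖ = 4 by norm_num] at this
    rw [hk, ← this]; ring
  rw [lineFactor_eq_quadricForm, hE, hk', h1, h2]
  apply MvPolynomial.funext
  intro q
  rw [eval_quadricForm]
  simp only [conicMatrix, dotProduct, mulVec, Fin.sum_univ_three, map_mul, map_add,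
    MvPolynomial.eval_C, pointForm, MvPolynomial.eval_X]
  simp [pow_two]
  ring

theorem curveOf_lineFactor {α β z : ℂ} {h : ℝ} (hb : Admissible α β z h) :
    curveOf (lineFactor α β z h) = hyperbolaHat α β z h := by
  rcases hb.1.eq_or_lt with hk | hk
  · rw [lineFactor_eq_mul hk.symm, curveOf_mul, curveOf_pointForm, curveOf_pointForm]
    have hM : nonTransverseAxis α β z h = 0 := by
      rw [nonTransverseAxis_eq, ← hk]; simp
    have hN := hb.axes_sq_add
    rw [hM, zero_pow two_ne_zero, add_zero, pow_left_inj₀ hb.transverseAxis_pos.le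
      (norm_nonneg _) two_ne_zero] at hN
    ext w
    simp only [hyperbolaHat, hyperbola, Set.mem_ofPred_eq, hM, hN, forall_const, Set.mem_union,
      Set.mem_singleton_iff]
    constructor
    · intro hw
      refine ⟨by ring, ?_, hw⟩
      rcases hw with rfl | rfl
      · simp
      · simp [norm_sub_rev]
    · exact fun hw => hw.2.2
  · have hd : ‖Delta α β z / 4‖ ^ 2 - mixedCoeff α β h ^ 2 / 4 ≠ 0 := by
      rw [norm_div]
      have : ‖(4 : ℂ)‖ = 4 := by norm_num
      rw [this]
      have h1 : 0 < (‖Delta α β z‖ / 2 - mixedCoeff α β h) *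
          (‖Delta α β z‖ / 2 + mixedCoeff α β h) :=
        mul_pos (by linarith [hb.2]) (by linarith)
      nlinarith
    have hdet : (conicMatrix ((α + β) / 2) (Delta α β z / 4) (mixedCoeff α β h)).det ≠ 0 := by
      rw [det_conicMatrix, Complex.ofReal_ne_zero]
      exact div_ne_zero (neg_ne_zero.2 hd) (by norm_num)
    have hsymm := conicMatrix_isSymm ((α + β) / 2) (Delta α β z / 4) (mixedCoeff α β h)
    rw [lineFactor_eq_quadricForm, curveOf_of_irreducible (irreducible_quadricForm hsymm hdet)]
    ext w
    have hne : ![(w.re : ℂ), (w.im : ℂ), 1] ≠ 0 := fun h0 => by simpa using congrFun h0 2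
    rw [Set.mem_ofPred_eq, mem_dualCone_quadricForm hsymm hdet hne, dual_conicMatrix,
      Complex.ofReal_eq_zero, hb.mem_hyperbolaHat_iff]
    simp only [← sub_eq_iff_eq_add', exists_contactPoint_iff hd]
    constructor
    · intro h0; linarith
    · intro h0; rw [h0]; simp

theorem kippenhahnCurve_blockMatrix {r m : ℕ} (hmr : m ≤ r) (α β : ℂ)
    (C : Matrix (Fin r) (Fin m) ℂ) (D : Matrix (Fin m) (Fin r) ℂ)
    (U : Matrix (Fin m) (Fin m) ℂ) (hU : U ∈ Matrix.unitaryGroup (Fin m) ℂ)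
    (z : Fin m → ℂ) (h : Fin m → ℝ)
    (hz : Uᴴ * (D * C) * U = Matrix.diagonal z)
    (hh : Uᴴ * (Cᴴ * C + D * Dᴴ) * U = Matrix.diagonal (fun j => (h j : ℂ)))
    (hb : ∀ j, Admissible α β (z j) (h j)) :
    kippenhahnCurve (blockMatrix α β C D) =
      (⋃ j, hyperbolaHat α β (z j) (h j)) ∪ {w | m < r ∧ w = α} := by
  rw [kippenhahnCurve_eq_curveOf, linePolynomial_blockMatrix hmr α β C D U hU z h hz hh,
    curveOf_mul, curveOf_pow, curveOf_pointForm, curveOf_prod, Set.union_comm]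
  congr 1
  · simp [curveOf_lineFactor (hb _)]
  · ext w; simp

/-! ### Convexity of the numerical cone, signed hulls and separation -/

theorem exists_mul_conj_eq {a b : ℝ} {ζ : ℂ} (ha : 0 ≤ a) (hb : 0 ≤ b)
    (hab : ‖ζ‖ ^ 2 = a * b) :
    ∃ l k : ℂ, Complex.normSq l = a ∧ Complex.normSq k = b ∧ l * conj k = ζ := by
  rcases ha.eq_or_lt with rfl | ha
  · refine ⟨0, Real.sqrt b, by simp, ?_, ?_⟩
    · rw [Complex.normSq_ofReal, Real.mul_self_sqrt hb]
    · have : ζ = 0 := by simpa using hab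
      simp [this]
  · have hs : Real.sqrt a ≠ 0 := (Real.sqrt_pos.2 ha).ne'
    refine ⟨Real.sqrt a, conj ζ / Real.sqrt a, ?_, ?_, ?_⟩
    · rw [Complex.normSq_ofReal, Real.mul_self_sqrt ha.le]
    · rw [map_div₀, Complex.normSq_ofReal, Real.mul_self_sqrt ha.le, Complex.normSq_conj,
        Complex.normSq_eq_norm_sq, hab]
      field_simp
    · have hs' : (Real.sqrt a : ℂ) ≠ 0 := by exact_mod_cast hs
      rw [map_div₀, Complex.conj_conj, Complex.conj_ofReal]
      field_simp

/-- A linear map from Hermitian `2 × 2` matrices to a three-dimensional space takes its value at the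
identity also at a positive semidefinite matrix `(l, k)(l, k)^*` of rank at most one: the space of
Hermitian matrices is four-dimensional, so the value is constant on a line through the identity,
and this line leaves the cone of positive semidefinite matrices. -/
theorem exists_rank_one_value (a b : ℂ × ℝ) (L : ℂ →ₗ[ℝ] ℂ × ℝ) :
    ∃ l k : ℂ, Complex.normSq l • a + Complex.normSq k • b + L (l * conj k) = a + b := by
  let T : ℝ × ℝ × ℂ →ₗ[ℝ] ℂ × ℝ :=
    (LinearMap.toSpanSingleton ℝ _ a).coprod ((LinearMap.toSpanSingleton ℝ _ b).coprod L)
  have hT : ∀ p q ζ, T (p, q, ζ) = p • a + (q • b + L ζ) := fun p q ζ => by simp [T]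
  have hker : T.ker ≠ ⊥ := by
    apply LinearMap.ker_ne_bot_of_finrank_lt
    simp [Module.finrank_prod, Complex.finrank_real_complex]
  obtain ⟨v, hv, hv0⟩ := Submodule.exists_mem_ne_zero_of_ne_bot hker
  -- up to sign, the trace of the kernel element is nonnegative
  obtain ⟨p, q, ζ, hpq, hne, hzero⟩ : ∃ (p q : ℝ) (ζ : ℂ), 0 ≤ p + q ∧
      ((p, q, ζ) : ℝ × ℝ × ℂ) ≠ 0 ∧ p • a + (q • b + L ζ) = 0 := by
    obtain ⟨p, q, ζ⟩ := v
    rcases le_total 0 (p + q) with h | h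
    · exact ⟨p, q, ζ, h, hv0, by rw [← hT]; exact hv⟩
    · refine ⟨-p, -q, -ζ, by linarith, ?_, ?_⟩
      · intro h0; apply hv0; simpa using h0
      · have : T (p, q, ζ) = 0 := hv
        rw [hT] at this
        rw [map_neg, neg_smul, neg_smul, ← neg_add, ← neg_add, this, neg_zero]
  set ρ := Real.sqrt ((p - q) ^ 2 + 4 * ‖ζ‖ ^ 2) with hρ
  have hρ0 : 0 ≤ ρ := Real.sqrt_nonneg _
  have hρ2 : ρ ^ 2 = (p - q) ^ 2 + 4 * ‖ζ‖ ^ 2 := Real.sq_sqrt (by positivity)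
  -- the eigenvalue of largest modulus
  obtain ⟨Λ, hΛ⟩ : ∃ Λ, Λ = (p + q + ρ) / 2 := ⟨_, rfl⟩
  have hΛpos : 0 < Λ := by
    rcases (show 0 ≤ Λ by rw [hΛ]; linarith).eq_or_lt with h | h
    · exfalso
      have h1 : ρ = 0 := by linarith
      have h2 : p + q = 0 := by linarith
      rw [h1] at hρ2
      have h3 : p - q = 0 := by nlinarith [sq_nonneg (p - q), sq_nonneg ‖ζ‖]
      have h4 : ‖ζ‖ = 0 := by nlinarith [sq_nonneg (p - q), sq_nonneg ‖ζ‖]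
      apply hne
      rw [norm_eq_zero.1 h4, show p = 0 by linarith, show q = 0 by linarith]
      rfl
    · exact h
  have habs : |p - q| ≤ ρ := abs_le_of_sq_le_sq (by nlinarith [sq_nonneg ‖ζ‖]) hρ0
  have hchar : ‖ζ‖ ^ 2 = (Λ - p) * (Λ - q) := by
    rw [hΛ]; linear_combination (-1 / 4) * hρ2
  have hpΛ : p ≤ Λ := by rw [hΛ]; linarith [le_abs_self (p - q)]
  have hqΛ : q ≤ Λ := by rw [hΛ]; linarith [neg_abs_le (p - q)]
  obtain ⟨l, k, hl, hk, hlk⟩ := exists_mul_conj_eq (a := 1 - Λ⁻¹ * p) (b := 1 - Λ⁻¹ * q)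
    (ζ := (-Λ⁻¹) • ζ) (by field_simp; linarith) (by field_simp; linarith)
    (by rw [norm_smul, mul_pow, hchar, norm_neg, Real.norm_eq_abs, sq_abs]; field_simp)
  refine ⟨l, k, ?_⟩
  rw [hl, hk, hlk, map_smul]
  have : (1 - Λ⁻¹ * p) • a + (1 - Λ⁻¹ * q) • b + -Λ⁻¹ • L ζ =
      a + b - Λ⁻¹ • (p • a + (q • b + L ζ)) := by module
  rw [this, hzero, smul_zero, sub_zero]

/-- The pairs `([A x, x], [x, x])`. The second entry is the level of the pair; the numerical range
consists of the numbers `w` with `(w, 1)` or `-(w, 1)` among these pairs. -/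
def kreinCone {r m : ℕ} (A : Matrix (Fin r ⊕ Fin m) (Fin r ⊕ Fin m) ℂ) : Set (ℂ × ℝ) :=
  Set.range fun x => (inner (A *ᵥ x) x, (inner x x).re)

section

variable {r m : ℕ} (A : Matrix (Fin r ⊕ Fin m) (Fin r ⊕ Fin m) ℂ)

theorem inner_add_smul (l k : ℂ) (x y x' y' : Fin r ⊕ Fin m → ℂ) :
    inner (l • x + k • y) (l • x' + k • y') = Complex.normSq l * inner x x' +
      Complex.normSq k * inner y y' + (l * conj k * inner x y' + conj (l * conj k) * inner y x') := by
  simp only [inner, mulVec_add, mulVec_smul, star_add, star_smul, dotProduct_add, add_dotProduct,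
    smul_dotProduct, dotProduct_smul, smul_eq_mul, Complex.normSq_eq_conj_mul_self, map_mul,
    Complex.conj_conj, Complex.star_def]
  ring

/-- The Toeplitz-Hausdorff theorem for `kreinCone`. -/
theorem add_mem_kreinCone {u v : ℂ × ℝ} (hu : u ∈ kreinCone A) (hv : v ∈ kreinCone A) :
    u + v ∈ kreinCone A := by
  obtain ⟨x, rfl⟩ := hu
  obtain ⟨y, rfl⟩ := hv
  let L : ℂ →ₗ[ℝ] ℂ × ℝ :=
    { toFun := fun ζ => (ζ * inner (A *ᵥ x) y + conj ζ * inner (A *ᵥ y) x,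
        (ζ * inner x y + conj ζ * inner y x).re)
      map_add' := fun ζ ξ => by
        ext <;> simp <;> ring
      map_smul' := fun t ζ => by
        ext <;> simp <;> ring }
  obtain ⟨l, k, h⟩ := exists_rank_one_value (inner (A *ᵥ x) x, (inner x x).re)
    (inner (A *ᵥ y) y, (inner y y).re) L
  refine ⟨l • x + k • y, ?_⟩
  simp only
  rw [← h, mulVec_add, mulVec_smul, mulVec_smul, inner_add_smul, inner_add_smul]
  simp [L]
  ring

theorem smul_mem_kreinCone {t : ℝ} (ht : 0 ≤ t) {v : ℂ × ℝ} (hv : v ∈ kreinCone A) :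
    t • v ∈ kreinCone A := by
  obtain ⟨x, rfl⟩ := hv
  refine ⟨(Real.sqrt t : ℂ) • x, ?_⟩
  have h := inner_add_smul (Real.sqrt t : ℂ) 0 (A *ᵥ x) 0 x 0
  have h' := inner_add_smul (Real.sqrt t : ℂ) 0 x 0 x 0
  simp only [smul_zero, add_zero, Complex.normSq_ofReal, Real.mul_self_sqrt ht, map_zero,
    Complex.ofReal_zero, zero_mul, mul_zero] at h h'
  simp only [mulVec_smul, h, h']
  ext <;> simp

theorem inner_self_im (x : Fin r ⊕ Fin m → ℂ) : (inner x x).im = 0 := by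
  have : inner x x = ∑ i, (Complex.normSq (x (Sum.inl i)) : ℂ) -
      ∑ j, (Complex.normSq (x (Sum.inr j)) : ℂ) := by
    simp [inner, J, dotProduct, fromBlocks_mulVec, Fintype.sum_sum_type,
      Complex.normSq_eq_conj_mul_self, sub_eq_add_neg, neg_mulVec]
  rw [this]; simp

theorem mem_rangePos_iff {w : ℂ} : w ∈ rangePos A ↔ (w, (1 : ℝ)) ∈ kreinCone A := by
  constructor
  · rintro ⟨x, hx, rfl⟩
    exact ⟨x, by simp [hx]⟩
  · rintro ⟨x, hx⟩
    rw [Prod.mk.injEq] at hx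
    exact ⟨x, Complex.ext (by simpa using hx.2) (by simpa using inner_self_im x), hx.1.symm⟩

theorem mem_rangeNeg_iff {w : ℂ} : w ∈ rangeNeg A ↔ (w, (-1 : ℝ)) ∈ kreinCone A := by
  constructor
  · rintro ⟨x, hx, rfl⟩
    exact ⟨x, by simp [hx]⟩
  · rintro ⟨x, hx⟩
    rw [Prod.mk.injEq] at hx
    exact ⟨x, Complex.ext (by simpa using hx.2) (by simpa using inner_self_im x), hx.1.symm⟩

end

/-- The sign `±1` of a Boolean. -/
def signOf (s : Bool) : ℝ := if s then 1 else -1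

theorem signOf_not (s : Bool) : signOf (!s) = -signOf s := by
  cases s <;> simp [signOf]

/-- The operations that generate the signed hull are positive combinations of the vectors
`± (w, 1)`. -/
theorem signedHull_mem_cone {P M : Set ℂ} {K : Set (ℂ × ℝ)}
    (hadd : ∀ u ∈ K, ∀ v ∈ K, u + v ∈ K) (hsmul : ∀ t : ℝ, 0 ≤ t → ∀ v ∈ K, t • v ∈ K)
    (hP : ∀ w ∈ P, (w, (1 : ℝ)) ∈ K) (hM : ∀ w ∈ M, (-w, (-1 : ℝ)) ∈ K) {s : Bool} {w : ℂ}
    (h : SignedHull P M s w) : signOf s • (w, (1 : ℝ)) ∈ K := by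
  induction h with
  | pos hw => simpa [signOf] using hP _ hw
  | neg hw => simpa [signOf] using hM _ hw
  | @segment s w₁ w₂ t h₁ h₂ ht₀ ht₁ ih₁ ih₂ =>
    convert hadd _ (hsmul t ht₀ _ ih₁) _ (hsmul (1 - t) (by linarith) _ ih₂) using 1
    ext <;> simp <;> ring
  | @halfLine s w₁ w₂ t h₁ h₂ ht ih₁ ih₂ =>
    convert hadd _ (hsmul t (by linarith) _ ih₁) _ (hsmul (t - 1) (by linarith) _ ih₂) using 1
    rw [signOf_not]
    ext <;> simp <;> ring

/-- The vectors whose multiples at level `±1` are the signed points of the hull, together with the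
zero vector. -/
def hullRays (P M : Set ℂ) (s : Bool) : Set (ℂ × ℝ) :=
  {v | ∃ (t : ℝ) (w : ℂ), 0 ≤ t ∧ (t = 0 ∨ SignedHull P M s w) ∧ v = (t * signOf s) • (w, (1 : ℝ))}

/-- The convex cone over the signed hull. -/
def hullCone (P M : Set ℂ) : Set (ℂ × ℝ) :=
  {v | ∃ u₁ ∈ hullRays P M true, ∃ u₂ ∈ hullRays P M false, v = u₁ + u₂}

theorem add_mem_hullRays {P M : Set ℂ} {s : Bool} {u v : ℂ × ℝ} (hu : u ∈ hullRays P M s)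
    (hv : v ∈ hullRays P M s) : u + v ∈ hullRays P M s := by
  obtain ⟨t₁, w₁, ht₁, h₁, rfl⟩ := hu
  obtain ⟨t₂, w₂, ht₂, h₂, rfl⟩ := hv
  rcases h₁ with rfl | h₁
  · exact ⟨t₂, w₂, ht₂, h₂, by simp⟩
  rcases h₂ with rfl | h₂
  · exact ⟨t₁, w₁, ht₁, Or.inr h₁, by simp⟩
  rcases (add_nonneg ht₁ ht₂).eq_or_lt with h0 | h0
  · have h1 : t₁ = 0 := by linarith
    have h2 : t₂ = 0 := by linarith
    exact ⟨0, w₁, le_rfl, Or.inl rfl, by simp [h1, h2]⟩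
  · have hne : (t₁ : ℂ) + t₂ ≠ 0 := by exact_mod_cast h0.ne'
    refine ⟨t₁ + t₂, _, h0.le, Or.inr (h₁.segment h₂ (t := t₁ / (t₁ + t₂)) (by positivity)
      (by rw [div_le_one h0]; linarith)), ?_⟩
    ext1
    · simp; field_simp; ring
    · simp; ring

theorem smul_mem_hullRays {P M : Set ℂ} {s : Bool} {t : ℝ} (ht : 0 ≤ t) {v : ℂ × ℝ}
    (hv : v ∈ hullRays P M s) : t • v ∈ hullRays P M s := by
  obtain ⟨t₁, w₁, ht₁, h₁, rfl⟩ := hv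
  exact ⟨t * t₁, w₁, by positivity, h₁.imp (by rintro rfl; simp) id, by rw [smul_smul, mul_assoc]⟩

theorem zero_mem_hullRays {P M : Set ℂ} {s : Bool} : (0 : ℂ × ℝ) ∈ hullRays P M s :=
  ⟨0, 0, le_rfl, Or.inl rfl, by simp⟩

theorem add_mem_hullCone {P M : Set ℂ} {u v : ℂ × ℝ} (hu : u ∈ hullCone P M)
    (hv : v ∈ hullCone P M) : u + v ∈ hullCone P M := by
  obtain ⟨u₁, hu₁, u₂, hu₂, rfl⟩ := hu
  obtain ⟨v₁, hv₁, v₂, hv₂, rfl⟩ := hv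
  exact ⟨_, add_mem_hullRays hu₁ hv₁, _, add_mem_hullRays hu₂ hv₂, by abel⟩

theorem smul_mem_hullCone {P M : Set ℂ} {t : ℝ} (ht : 0 ≤ t) {v : ℂ × ℝ}
    (hv : v ∈ hullCone P M) : t • v ∈ hullCone P M := by
  obtain ⟨v₁, hv₁, v₂, hv₂, rfl⟩ := hv
  exact ⟨_, smul_mem_hullRays ht hv₁, _, smul_mem_hullRays ht hv₂, by rw [smul_add]⟩

theorem zero_mem_hullCone {P M : Set ℂ} : (0 : ℂ × ℝ) ∈ hullCone P M :=
  ⟨0, zero_mem_hullRays, 0, zero_mem_hullRays, by simp⟩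

theorem sum_mem_hullCone {P M : Set ℂ} {ι : Type*} (s : Finset ι) (v : ι → ℂ × ℝ)
    (hv : ∀ i ∈ s, v i ∈ hullCone P M) : ∑ i ∈ s, v i ∈ hullCone P M :=
  Finset.sum_induction v (· ∈ hullCone P M) (fun _ _ => add_mem_hullCone) zero_mem_hullCone hv

theorem mem_hullCone_of_signedHull {P M : Set ℂ} {s : Bool} {w : ℂ} (h : SignedHull P M s w) :
    signOf s • (w, (1 : ℝ)) ∈ hullCone P M := by
  have : signOf s • (w, (1 : ℝ)) ∈ hullRays P M s := ⟨1, w, zero_le_one, Or.inr h, by rw [one_mul]⟩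
  cases s
  · exact ⟨0, zero_mem_hullRays, _, this, by rw [zero_add]⟩
  · exact ⟨_, this, 0, zero_mem_hullRays, by rw [add_zero]⟩

/-- Conversely, a vector of level `±1` in the cone is obtained by a single half-line from one point
of either sign. -/
theorem signedHull_of_mem_hullCone {P M : Set ℂ} {s : Bool} {w : ℂ}
    (h : signOf s • (w, (1 : ℝ)) ∈ hullCone P M) : SignedHull P M s w := by
  obtain ⟨_, ⟨t₁, w₁, ht₁, h₁, rfl⟩, _, ⟨t₂, w₂, ht₂, h₂, rfl⟩, h⟩ := h
  rw [Prod.ext_iff] at h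
  obtain ⟨hw, hl⟩ := h
  simp only [signOf, Prod.smul_fst, Prod.smul_snd, Prod.fst_add, Prod.snd_add, if_true,
    Bool.false_eq_true, if_false, smul_eq_mul, mul_one, Complex.real_smul] at hw hl
  cases s
  · simp only [Bool.false_eq_true, if_false] at hw hl
    have ht : t₂ = 1 + t₁ := by linarith
    have h₂' : SignedHull P M false w₂ := h₂.resolve_left (by linarith)
    subst ht
    rcases h₁ with rfl | h₁
    · convert h₂' using 1
      push_cast at hw
      linear_combination -hw
    · convert h₂'.halfLine (s := false) h₁ (t := 1 + t₁) (by linarith) using 1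
      push_cast at hw ⊢
      linear_combination -hw
  · simp only [if_true] at hw hl
    have ht : t₁ = 1 + t₂ := by linarith
    have h₁' : SignedHull P M true w₁ := h₁.resolve_left (by linarith)
    subst ht
    rcases h₂ with rfl | h₂
    · convert h₁' using 1
      push_cast at hw
      linear_combination hw
    · convert h₁'.halfLine (s := true) h₂ (t := 1 + t₂) (by linarith) using 1
      push_cast at hw ⊢
      linear_combination hw

/-- Proper separation of a point from a convex cone, closed or not, in a finite-dimensional
space. -/
theorem exists_proper_separation {E : Type*} [NormedAddCommGroup E] [NormedSpace ℝ E]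
    [FiniteDimensional ℝ E] {K : Set E} (hzero : 0 ∈ K) (hadd : ∀ u ∈ K, ∀ v ∈ K, u + v ∈ K)
    (hsmul : ∀ t : ℝ, 0 ≤ t → ∀ v ∈ K, t • v ∈ K) {v : E} (hv : v ∉ K) :
    ∃ f : E →ₗ[ℝ] ℝ, (∀ g ∈ K, 0 ≤ f g) ∧ f v ≤ 0 ∧ ((∃ g ∈ K, f g ≠ 0) ∨ f v < 0) := by
  by_cases hspan : v ∈ Submodule.span ℝ K
  swap
  · obtain ⟨f, hfv, hf⟩ := Submodule.exists_le_ker_of_notMem hspan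
    have hK : ∀ g ∈ K, f g = 0 := fun g hg => hf (Submodule.subset_span hg)
    rcases lt_or_gt_of_ne hfv with h | h
    · exact ⟨f, fun g hg => (hK g hg).ge, h.le, Or.inr h⟩
    · exact ⟨-f, fun g hg => by simp [hK g hg], by simpa using h.le, Or.inr (by simpa using h)⟩
  -- inside its linear span the cone has nonempty interior
  set S := Submodule.span ℝ K with hS
  let K' : Set S := {g | (g : E) ∈ K}
  have hconv : Convex ℝ K' := by
    intro x hx y hy a b ha hb _
    exact hadd _ (hsmul a ha _ hx) _ (hsmul b hb _ hy)
  have hspan' : Submodule.span ℝ K' = ⊤ := by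
    have := Submodule.span_span_coe_preimage (R := ℝ) (s := K)
    exact this
  have hzero' : (0 : S) ∈ K' := hzero
  have hint : (interior K').Nonempty := by
    rw [hconv.interior_nonempty_iff_affineSpan_eq_top]
    rw [← Set.insert_eq_of_mem hzero', ← AffineSubspace.coe_eq_univ_iff, affineSpan_insert_zero,
      hspan', Submodule.top_coe]
  have hv' : (⟨v, hspan⟩ : S) ∉ interior K' := fun h => hv (interior_subset (s := K') h)
  obtain ⟨f, hf⟩ := geometric_hahn_banach_open_point hconv.interior isOpen_interior hv'
  have hle : ∀ g ∈ K', f g ≤ f ⟨v, hspan⟩ := by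
    have hcl : closure (interior K') ⊆ {g | f g ≤ f ⟨v, hspan⟩} :=
      closure_minimal (fun g hg => (hf g hg).le) (isClosed_le f.continuous continuous_const)
    rw [hconv.closure_interior_eq_closure_of_nonempty_interior hint] at hcl
    exact fun g hg => hcl (subset_closure hg)
  have hnonpos : ∀ g ∈ K', f g ≤ 0 := by
    intro g hg
    by_contra! hpos
    have h0 : 0 ≤ f ⟨v, hspan⟩ := by simpa using hle 0 hzero'
    have := hle (((f ⟨v, hspan⟩ + 1) / f g) • g) (hsmul _ (by positivity) _ hg)
    rw [map_smul, smul_eq_mul, div_mul_cancel₀ _ hpos.ne'] at this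
    linarith
  obtain ⟨F, hF⟩ := LinearMap.exists_extend (-(f : S →ₗ[ℝ] ℝ))
  have hFf : ∀ (g : E) (hg : g ∈ S), F g = -f ⟨g, hg⟩ := by
    intro g hg
    have := LinearMap.congr_fun hF ⟨g, hg⟩
    simpa using this
  have hv0 : 0 ≤ f ⟨v, hspan⟩ := by simpa using hle 0 hzero'
  refine ⟨F, fun g hg => ?_, ?_, ?_⟩
  · rw [hFf g (Submodule.subset_span hg)]
    linarith [hnonpos ⟨g, Submodule.subset_span hg⟩ hg]
  · rw [hFf v hspan]; linarith
  · obtain ⟨g, hg⟩ := hint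
    by_cases hg0 : f g = 0
    · right
      rw [hFf v hspan]
      have := hf g hg
      linarith
    · left
      refine ⟨g, interior_subset (s := K') hg, ?_⟩
      rw [hFf g g.2]
      simpa using hg0

/-! ### Values of the block matrix -/

/-- The square of the Euclidean norm. -/
def sqNorm {ι : Type*} [Fintype ι] (p : ι → ℂ) : ℝ := ∑ i, Complex.normSq (p i)

theorem star_dotProduct_self {ι : Type*} [Fintype ι] (p : ι → ℂ) :
    star p ⬝ᵥ p = (sqNorm p : ℂ) := by
  simp [sqNorm, dotProduct, Complex.normSq_eq_conj_mul_self]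

theorem sqNorm_nonneg {ι : Type*} [Fintype ι] (p : ι → ℂ) : 0 ≤ sqNorm p :=
  Finset.sum_nonneg fun i _ => Complex.normSq_nonneg (p i)

theorem sqNorm_eq_zero {ι : Type*} [Fintype ι] {p : ι → ℂ} (h : sqNorm p = 0) : p = 0 := by
  ext i
  exact Complex.normSq_eq_zero.1
    ((Finset.sum_eq_zero_iff_of_nonneg fun i _ => Complex.normSq_nonneg (p i)).1 h i
      (Finset.mem_univ i))

theorem sqNorm_smul {ι : Type*} [Fintype ι] (a : ℂ) (p : ι → ℂ) :
    sqNorm (a • p) = Complex.normSq a * sqNorm p := by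
  simp [sqNorm, Finset.mul_sum]

theorem sqNorm_add {ι : Type*} [Fintype ι] (p q : ι → ℂ) :
    sqNorm (p + q) = sqNorm p + sqNorm q + 2 * (star p ⬝ᵥ q).re := by
  have h : star (p + q) ⬝ᵥ (p + q) =
      star p ⬝ᵥ p + star q ⬝ᵥ q + (star p ⬝ᵥ q + conj (star p ⬝ᵥ q)) := by
    have : conj (star p ⬝ᵥ q) = star q ⬝ᵥ p := by
      rw [← Complex.star_def, star_dotProduct, star_star, dotProduct_comm]
    rw [this, star_add, add_dotProduct, dotProduct_add, dotProduct_add]; ring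
  rw [star_dotProduct_self, star_dotProduct_self, star_dotProduct_self, Complex.add_conj] at h
  exact_mod_cast h

section

variable {r m : ℕ} (α β : ℂ) (C : Matrix (Fin r) (Fin m) ℂ) (D : Matrix (Fin m) (Fin r) ℂ)

/-- The pair `([A x, x], [x, x])` for `A = blockMatrix α β C D` and `x = (p, y)`. -/
def blockValue (p : Fin r → ℂ) (y : Fin m → ℂ) : ℂ × ℝ :=
  (α * sqNorm p + star p ⬝ᵥ (C *ᵥ y) - star y ⬝ᵥ (D *ᵥ p) - β * sqNorm y, sqNorm p - sqNorm y)

/-- A unitary change of coordinates in the second block is a `J`-unitary change of basis. -/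
theorem mem_kreinCone_blockMatrix_iff {U : Matrix (Fin m) (Fin m) ℂ}
    (hU : U ∈ Matrix.unitaryGroup (Fin m) ℂ) {v : ℂ × ℝ} :
    v ∈ kreinCone (blockMatrix α β C D) ↔ ∃ p y, v = blockValue α β (C * U) (Uᴴ * D) p y := by
  have hval : ∀ p y, (inner (blockMatrix α β C D *ᵥ Sum.elim p y) (Sum.elim p y),
      (inner (Sum.elim p y) (Sum.elim p y)).re) = blockValue α β C D p y := by
    intro p y
    have hstar : star (Sum.elim p y) = Sum.elim (star p) (star y) := by
      ext i; rcases i with i | i <;> rfl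
    ext1
    · simp only [inner, blockMatrix, J, fromBlocks_mulVec, blockValue, hstar,
        sumElim_dotProduct_sumElim, Sum.elim_comp_inl, Sum.elim_comp_inr, smul_mulVec, one_mulVec,
        zero_mulVec, add_zero, zero_add, neg_mulVec, dotProduct_add, dotProduct_neg,
        dotProduct_smul, star_dotProduct_self, smul_eq_mul]
      ring
    · simp only [inner, J, fromBlocks_mulVec, blockValue, hstar,
        sumElim_dotProduct_sumElim, Sum.elim_comp_inl, Sum.elim_comp_inr, one_mulVec,
        zero_mulVec, add_zero, zero_add, neg_mulVec, dotProduct_neg, star_dotProduct_self]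
      simp [sub_eq_add_neg]
  have hU1 : Uᴴ * U = 1 := (Matrix.mem_unitaryGroup_iff').1 hU
  have hU2 : U * Uᴴ = 1 := Matrix.mem_unitaryGroup_iff.1 hU
  have hconj : ∀ p y, blockValue α β (C * U) (Uᴴ * D) p y = blockValue α β C D p (U *ᵥ y) := by
    intro p y
    have hn : sqNorm (U *ᵥ y) = sqNorm y := by
      have : star (U *ᵥ y) ⬝ᵥ (U *ᵥ y) = star y ⬝ᵥ y := by
        rw [star_mulVec, ← dotProduct_mulVec, mulVec_mulVec, hU1, one_mulVec]
      rw [star_dotProduct_self, star_dotProduct_self] at this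
      exact_mod_cast this
    rw [blockValue, blockValue, hn, star_mulVec, ← dotProduct_mulVec, mulVec_mulVec,
      mulVec_mulVec]
  constructor
  · rintro ⟨x, rfl⟩
    refine ⟨x ∘ Sum.inl, Uᴴ *ᵥ (x ∘ Sum.inr), ?_⟩
    rw [hconj, mulVec_mulVec, hU2, one_mulVec, ← hval, Sum.elim_comp_inl_inr]
  · rintro ⟨p, y, rfl⟩
    exact ⟨Sum.elim p (U *ᵥ y), by rw [hconj]; exact hval _ _⟩

/-- The off-diagonal block of the Hermitian form that a real linear functional with line coordinate
`s` induces on pairs `(p, y)`. -/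
def offDiagonal (s : ℂ) : Matrix (Fin r) (Fin m) ℂ := s • C - conj s • Dᴴ

/-- The eigenvalues of `K^* K` for `K = offDiagonal C D s`. -/
def gramValue (z : ℂ) (h : ℝ) (s : ℂ) : ℝ := Complex.normSq s * h - 2 * (s ^ 2 * z).re

/-- The quadratic factor of the line polynomial is the `2 × 2` determinant of the Hermitian form on
an eigenvector: in line coordinates `(s, ω)` it equals `ω² - tangentForm s`. -/
theorem tangentForm_eq_sub_gramValue (z : ℂ) (h : ℝ) (s : ℂ) :
    tangentForm (Delta α β z / 4) (mixedCoeff α β h) s =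
      (s * (α - β)).re ^ 2 - gramValue z h s := by
  rw [tangentForm, mixedCoeff, gramValue, Delta, sq_norm_eq]
  have : ((α - β) ^ 2 + 4 * z) / 4 * s ^ 2 = (s * (α - β)) ^ 2 / 4 + s ^ 2 * z := by ring
  rw [this, Complex.normSq_apply]
  simp [pow_two]
  ring

/-- Polarization of `tangentForm_eq_sub_gramValue`. -/
theorem contactPoint_eq (z : ℂ) (h : ℝ) (s : ℂ) :
    contactPoint (Delta α β z / 4) (mixedCoeff α β h) s =
      (α - β) / 2 * ((s * (α - β)).re : ℂ) + s * z - conj s * (h : ℂ) / 2 := by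
  have h1 : ((s * (α - β)).re : ℂ) = (s * (α - β) + conj (s * (α - β))) / 2 :=
    Complex.re_eq_add_conj _
  have h2 : ((mixedCoeff α β h / 2 : ℝ) : ℂ) = (h : ℂ) / 2 - (α - β) * conj (α - β) / 4 := by
    rw [Complex.mul_conj, Complex.normSq_eq_norm_sq, mixedCoeff]; push_cast; ring
  rw [contactPoint, h1, h2, Delta, map_mul]
  ring

/-- The value on `blockValue` of the functional `(w, ℓ) ↦ 2 Re (s (w - c ℓ)) + ω ℓ`, where
`c = (α + β) / 2`. -/
theorem functional_blockValue (s : ℂ) (ω : ℝ) (p : Fin r → ℂ) (y : Fin m → ℂ) :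
    2 * (s * ((blockValue α β C D p y).1 - (α + β) / 2 * (blockValue α β C D p y).2)).re +
        ω * (blockValue α β C D p y).2 =
      ((s * (α - β)).re + ω) * sqNorm p + ((s * (α - β)).re - ω) * sqNorm y +
        2 * (star p ⬝ᵥ (offDiagonal C D s *ᵥ y)).re := by
  have h1 : star p ⬝ᵥ (offDiagonal C D s *ᵥ y) =
      s * (star p ⬝ᵥ (C *ᵥ y)) - conj (s * (star y ⬝ᵥ (D *ᵥ p))) := by
    have : star p ⬝ᵥ (Dᴴ *ᵥ y) = conj (star y ⬝ᵥ (D *ᵥ p)) := by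
      rw [← Complex.star_def, star_dotProduct, star_mulVec, conjTranspose_conjTranspose,
        ← dotProduct_mulVec]
    rw [offDiagonal, sub_mulVec, smul_mulVec, smul_mulVec, dotProduct_sub, dotProduct_smul,
      dotProduct_smul, smul_eq_mul, smul_eq_mul, map_mul, this]
  rw [h1, Complex.sub_re, Complex.conj_re]
  simp only [blockValue]
  generalize star p ⬝ᵥ (C *ᵥ y) = A
  generalize star y ⬝ᵥ (D *ᵥ p) = B
  generalize sqNorm p = P
  generalize sqNorm y = Y
  simp
  ring

variable {C D} {z : Fin m → ℂ} {h : Fin m → ℝ}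

theorem conjTranspose_offDiagonal (s : ℂ) :
    (offDiagonal C D s)ᴴ = conj s • Cᴴ - s • D := by
  rw [offDiagonal, conjTranspose_sub, conjTranspose_smul, conjTranspose_smul,
    conjTranspose_conjTranspose, Complex.star_def, Complex.conj_conj]

theorem star_dotProduct_diagonal_mulVec (d : Fin m → ℂ) (y : Fin m → ℂ) :
    star y ⬝ᵥ (Matrix.diagonal d *ᵥ y) = ∑ j, d j * Complex.normSq (y j) := by
  simp only [dotProduct, mulVec_diagonal, Complex.normSq_eq_conj_mul_self, Pi.star_apply,
    Complex.star_def]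
  exact Finset.sum_congr rfl fun j _ => by ring

theorem sqNorm_offDiagonal_mulVec (hz : D * C = Matrix.diagonal z)
    (hh : Cᴴ * C + D * Dᴴ = Matrix.diagonal fun j => (h j : ℂ)) (s : ℂ) (y : Fin m → ℂ) :
    sqNorm (offDiagonal C D s *ᵥ y) = ∑ j, gramValue (z j) (h j) s * Complex.normSq (y j) := by
  have hzc : Cᴴ * Dᴴ = Matrix.diagonal fun j => conj (z j) := by
    rw [← conjTranspose_mul, hz, diagonal_conjTranspose]; rfl
  have hK : (offDiagonal C D s)ᴴ * offDiagonal C D s =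
      Matrix.diagonal fun j => (gramValue (z j) (h j) s : ℂ) := by
    have : (offDiagonal C D s)ᴴ * offDiagonal C D s =
        (s * conj s) • (Cᴴ * C + D * Dᴴ) - s ^ 2 • (D * C) - conj s ^ 2 • (Cᴴ * Dᴴ) := by
      rw [conjTranspose_offDiagonal, offDiagonal]
      simp only [Matrix.sub_mul, Matrix.mul_sub, Matrix.smul_mul, Matrix.mul_smul]
      module
    rw [this, hh, hz, hzc]
    ext i j
    by_cases hij : i = j
    · subst hij
      have := Complex.add_conj (s ^ 2 * z i)
      simp only [Matrix.sub_apply, Matrix.smul_apply, diagonal_apply_eq, gramValue, smul_eq_mul]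
      push_cast
      push_cast at this
      rw [← this, Complex.mul_conj, map_mul, map_pow]
      ring
    · simp [hij]
  have := star_dotProduct_self (offDiagonal C D s *ᵥ y)
  rw [star_mulVec, ← dotProduct_mulVec, mulVec_mulVec, hK, star_dotProduct_diagonal_mulVec] at this
  exact_mod_cast this.symm

theorem gramValue_nonneg (hz : D * C = Matrix.diagonal z)
    (hh : Cᴴ * C + D * Dᴴ = Matrix.diagonal fun j => (h j : ℂ)) (s : ℂ) (j : Fin m) :
    0 ≤ gramValue (z j) (h j) s := by
  have := sqNorm_offDiagonal_mulVec hz hh s (Pi.single j 1)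
  rw [Finset.sum_eq_single j (fun i _ hij => by simp [hij]) (by simp)] at this
  simp only [Pi.single_eq_same, map_one, mul_one] at this
  rw [← this]
  exact sqNorm_nonneg _

/-- The cross terms between different eigenvectors cancel, although neither the columns of `C` nor
those of `D^*` need be orthogonal. -/
theorem cross_term_offDiagonal (hz : D * C = Matrix.diagonal z)
    (hh : Cᴴ * C + D * Dᴴ = Matrix.diagonal fun j => (h j : ℂ)) (s : ℂ) (y : Fin m → ℂ) :
    star (offDiagonal C D s *ᵥ y) ⬝ᵥ (C *ᵥ y) - star y ⬝ᵥ (D *ᵥ (offDiagonal C D s *ᵥ y)) =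
      ∑ j, (conj s * h j - 2 * s * z j) * Complex.normSq (y j) := by
  have hK : (offDiagonal C D s)ᴴ * C - D * offDiagonal C D s =
      Matrix.diagonal fun j => conj s * h j - 2 * s * z j := by
    have : (offDiagonal C D s)ᴴ * C - D * offDiagonal C D s =
        conj s • (Cᴴ * C + D * Dᴴ) - (2 * s) • (D * C) := by
      rw [conjTranspose_offDiagonal, offDiagonal]
      simp only [Matrix.sub_mul, Matrix.mul_sub, Matrix.smul_mul, Matrix.mul_smul]
      module
    rw [this, hh, hz]
    ext i j
    by_cases hij : i = j
    · subst hij; simp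
    · simp [hij]
  rw [star_mulVec, ← dotProduct_mulVec, mulVec_mulVec, mulVec_mulVec, ← dotProduct_sub,
    ← sub_mulVec, hK, star_dotProduct_diagonal_mulVec]

/-- Vectors in the kernel of the Hermitian form with diagonal entries `a = Re (s (α - β)) + ω` and
`-b = Re (s (α - β)) - ω`: their values are combinations of contact points, with the same level in
each summand. -/
theorem blockValue_kernel (hz : D * C = Matrix.diagonal z)
    (hh : Cᴴ * C + D * Dᴴ = Matrix.diagonal fun j => (h j : ℂ)) {s : ℂ} {ω : ℝ}
    (ha : (s * (α - β)).re + ω ≠ 0) {y : Fin m → ℂ}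
    (hy : ∀ j, y j ≠ 0 → tangentForm (Delta α β (z j) / 4) (mixedCoeff α β (h j)) s = ω ^ 2) :
    blockValue α β C D
        ((((-((s * (α - β)).re + ω)⁻¹ : ℝ) : ℂ)) • (offDiagonal C D s *ᵥ y)) y =
      ∑ j, (2 * Complex.normSq (y j) / ((s * (α - β)).re + ω)) •
        ((-ω * ((α + β) / 2) + contactPoint (Delta α β (z j) / 4) (mixedCoeff α β (h j)) s, -ω) :
          ℂ × ℝ) := by
  set R := (s * (α - β)).re with hR
  have hκ : ∀ j, gramValue (z j) (h j) s * Complex.normSq (y j) =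
      (R + ω) * (R - ω) * Complex.normSq (y j) := by
    intro j
    by_cases hj : y j = 0
    · simp [hj]
    · have := hy j hj
      rw [tangentForm_eq_sub_gramValue, ← hR] at this
      rw [show gramValue (z j) (h j) s = (R + ω) * (R - ω) by linear_combination -this]
  have hP : sqNorm (((-(R + ω)⁻¹ : ℝ) : ℂ) • (offDiagonal C D s *ᵥ y)) =
      ∑ j, (R - ω) / (R + ω) * Complex.normSq (y j) := by
    rw [sqNorm_smul, sqNorm_offDiagonal_mulVec hz hh, Finset.mul_sum, Complex.normSq_ofReal]
    refine Finset.sum_congr rfl fun j _ => ?_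
    rw [hκ]; field_simp
  have hcross := cross_term_offDiagonal hz hh s y
  have ha' : (R : ℂ) + ω ≠ 0 := by exact_mod_cast ha
  ext1
  · rw [Prod.fst_sum]
    simp only [blockValue, mulVec_smul, dotProduct_smul, star_smul, smul_dotProduct, smul_eq_mul,
      Complex.star_def, Complex.conj_ofReal, hP]
    have e1 : ∀ x x' : ℂ, α * x + ((-(R + ω)⁻¹ : ℝ) : ℂ) *
        (star (offDiagonal C D s *ᵥ y) ⬝ᵥ (C *ᵥ y)) - ((-(R + ω)⁻¹ : ℝ) : ℂ) *
        (star y ⬝ᵥ (D *ᵥ (offDiagonal C D s *ᵥ y))) - β * x' = α * x + ((-(R + ω)⁻¹ : ℝ) : ℂ) *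
        (star (offDiagonal C D s *ᵥ y) ⬝ᵥ (C *ᵥ y) -
          star y ⬝ᵥ (D *ᵥ (offDiagonal C D s *ᵥ y))) - β * x' := by
      intro x x'; ring
    rw [e1, hcross, sqNorm]
    push_cast
    rw [Finset.mul_sum, Finset.mul_sum, Finset.mul_sum, ← Finset.sum_add_distrib,
      ← Finset.sum_sub_distrib]
    refine Finset.sum_congr rfl fun j _ => ?_
    rw [contactPoint_eq, ← hR, Prod.smul_fst, Complex.real_smul]
    push_cast
    field_simp
    ring
  · rw [Prod.snd_sum]
    simp only [blockValue, hP, Prod.smul_snd, smul_eq_mul]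
    rw [sqNorm, ← Finset.sum_sub_distrib]
    refine Finset.sum_congr rfl fun j _ => ?_
    field_simp
    ring

/-- If the form `gramValue` vanishes at `s`, then so does its gradient. -/
theorem contact_term_eq_zero (hz : D * C = Matrix.diagonal z)
    (hh : Cᴴ * C + D * Dᴴ = Matrix.diagonal fun j => (h j : ℂ)) {s : ℂ} {j : Fin m}
    (h0 : gramValue (z j) (h j) s = 0) : s * z j - conj s * (h j : ℂ) / 2 = 0 := by
  have hn := sqNorm_offDiagonal_mulVec hz hh s (Pi.single j 1)
  rw [Finset.sum_eq_single j (fun i _ hij => by simp [hij]) (by simp), h0, zero_mul] at hn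
  have hc := cross_term_offDiagonal hz hh s (Pi.single j 1)
  rw [Finset.sum_eq_single j (fun i _ hij => by simp [hij]) (by simp), sqNorm_eq_zero hn] at hc
  simp only [star_zero, zero_dotProduct, mulVec_zero, dotProduct_zero, sub_self,
    Pi.single_eq_same, map_one, Complex.ofReal_one, mul_one] at hc
  linear_combination hc / 2

end

/-! ### Duality for a branch of a hyperbola -/

/-- A linear functional that is at least `ω` on a branch of the unit hyperbola has Lorentz norm at
least `ω`. -/
theorem sq_add_sq_le_of_forall_le {A B ω : ℝ} (hω : 0 ≤ ω)
    (h : ∀ t : ℝ, ω ≤ A * Real.sqrt (1 + t ^ 2) - B * t) : ω ^ 2 + B ^ 2 ≤ A ^ 2 := by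
  have hA : ω ≤ A := by simpa using h 0
  have hlin : ∀ T : ℝ, 0 ≤ T → ω + |B| * T ≤ A * Real.sqrt (1 + T ^ 2) := by
    intro T hT
    rcases le_total 0 B with hB | hB
    · have := h T
      rw [abs_of_nonneg hB]
      linarith
    · have := h (-T)
      rw [neg_sq] at this
      rw [abs_of_nonpos hB]
      linarith
  have hsq : ∀ T : ℝ, 0 ≤ T →
      0 ≤ (A ^ 2 - B ^ 2) * T ^ 2 - 2 * (ω * |B|) * T + (A ^ 2 - ω ^ 2) := by
    intro T hT
    have h1 : (ω + |B| * T) ^ 2 ≤ (A * Real.sqrt (1 + T ^ 2)) ^ 2 :=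
      pow_le_pow_left₀ (by positivity) (hlin T hT) 2
    rw [mul_pow, Real.sq_sqrt (by positivity)] at h1
    nlinarith [sq_abs B]
  have hωA : ω ^ 2 ≤ A ^ 2 := pow_le_pow_left₀ hω hA 2
  have hωB : 0 ≤ ω * |B| := by positivity
  rcases lt_trichotomy (A ^ 2 - B ^ 2) 0 with hD | hD | hD
  · exfalso
    -- the quadratic polynomial has a negative leading coefficient
    have h1 := hsq ((A ^ 2 - ω ^ 2) / (B ^ 2 - A ^ 2) + 1)
      (by have : 0 < B ^ 2 - A ^ 2 := by linarith
          have : 0 ≤ A ^ 2 - ω ^ 2 := by linarith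
          positivity)
    have hpos : 0 < B ^ 2 - A ^ 2 := by linarith
    obtain ⟨x, hx⟩ : ∃ x, x = (A ^ 2 - ω ^ 2) / (B ^ 2 - A ^ 2) := ⟨_, rfl⟩
    have hx0 : 0 ≤ x := by rw [hx]; exact div_nonneg (by linarith) hpos.le
    have hxe : x * (B ^ 2 - A ^ 2) = A ^ 2 - ω ^ 2 := by rw [hx]; field_simp
    rw [← hx, ← hxe] at h1
    nlinarith [mul_nonneg hωB hx0, mul_nonneg hpos.le hx0, mul_nonneg (mul_nonneg hpos.le hx0) hx0]
  · -- the polynomial is affine, so its slope vanishes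
    have hz : ω * |B| = 0 := by
      by_contra hne
      have hpos : 0 < ω * |B| := lt_of_le_of_ne hωB (Ne.symm hne)
      have h1 := hsq ((A ^ 2 - ω ^ 2) / (ω * |B|) + 1)
        (by have : 0 ≤ A ^ 2 - ω ^ 2 := by linarith
            positivity)
      rw [hD] at h1
      have : 2 * (ω * |B|) * ((A ^ 2 - ω ^ 2) / (ω * |B|) + 1) =
          2 * (A ^ 2 - ω ^ 2) + 2 * (ω * |B|) := by
        rw [mul_add, mul_one, mul_assoc, mul_div_cancel₀ _ hne]
      rw [this] at h1
      linarith
    rcases mul_eq_zero.1 hz with h0 | h0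
    · rw [h0]; linarith
    · rw [abs_eq_zero.1 h0] at hD ⊢; linarith
  · have h1 := hsq (ω * |B| / (A ^ 2 - B ^ 2)) (by positivity)
    have h2 : (A ^ 2 - B ^ 2) * (ω * |B| / (A ^ 2 - B ^ 2)) ^ 2 -
        2 * (ω * |B|) * (ω * |B| / (A ^ 2 - B ^ 2)) + (A ^ 2 - ω ^ 2) =
        A ^ 2 * (A ^ 2 - B ^ 2 - ω ^ 2) / (A ^ 2 - B ^ 2) := by
      have h3 := sq_abs B
      field_simp
      rw [h3]; ring
    rw [h2, le_div_iff₀ hD, zero_mul] at h1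
    have hA2 : 0 < A ^ 2 := by nlinarith [sq_nonneg B]
    nlinarith [nonneg_of_mul_nonneg_right h1 hA2]

/-- Duality between a branch of the hyperbola and the cone of line coordinates: a functional that is
nonnegative on the positive branch and nonpositive on the negative branch has coordinates inside the
cone where `tangentForm E k s' ≥ ω²`, on the nappe determined by `d`. -/
theorem tangentForm_ge_of_forall_le {E d : ℂ} {k : ℝ} (hk₁ : -(2 * ‖E‖) ≤ k) (hk₂ : k < 2 * ‖E‖)
    (hd : ∀ s, tangentForm E k s ≤ (s * d).re ^ 2) {s' : ℂ} {ω : ℝ}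
    (H : ∀ s, tangentForm E k s = 1 → 0 < (s * d).re → |ω| ≤ 2 * (s' * contactPoint E k s).re) :
    ω ^ 2 ≤ tangentForm E k s' ∧ 0 ≤ (s' * d).re := by
  -- the square root of `E` on the side of `d`
  obtain ⟨e, heE, hed⟩ : ∃ e : ℂ, e ^ 2 = E ∧ 0 ≤ (conj e * d).re := by
    rcases le_total 0 (conj (Complex.sqrt E) * d).re with h | h
    · exact ⟨_, complex_sqrt_sq E, h⟩
    · exact ⟨-Complex.sqrt E, by rw [neg_sq, complex_sqrt_sq], by
        rw [map_neg, neg_mul, Complex.neg_re]; linarith⟩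
  have hEe : ‖E‖ = ‖e‖ ^ 2 := by rw [← heE, norm_pow]
  obtain ⟨n, hn⟩ : ∃ n, n = ‖e‖ := ⟨_, rfl⟩
  have hn0 : 0 < n := by
    rw [hn, norm_pos_iff]
    rintro rfl
    rw [hEe] at hk₁ hk₂
    simp at hk₁ hk₂
    linarith
  rw [hEe, ← hn] at hk₁ hk₂
  -- real coordinates that diagonalize the form
  set S : ℝ → ℝ → ℂ := fun X Y => conj e / n * (X + Y * Complex.I) with hS
  set d₁ := (conj e * d).re / n with hd₁
  set d₂ := (conj e * d).im / n with hd₂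
  have hn0' : (n : ℂ) ≠ 0 := by exact_mod_cast hn0.ne'
  have hee : e * conj e = (n : ℂ) ^ 2 := by
    rw [hn, Complex.mul_conj']
  have heS : ∀ X Y, e * S X Y = n * (X + Y * Complex.I) := by
    intro X Y
    rw [hS]
    simp only
    field_simp
    rw [hee]
  have hnorm : ∀ X Y, Complex.normSq (S X Y) = X ^ 2 + Y ^ 2 := by
    intro X Y
    have h1 := congrArg Complex.normSq (heS X Y)
    rw [map_mul, map_mul (f := Complex.normSq) (n : ℂ), Complex.normSq_eq_norm_sq e, ← hn,
      Complex.normSq_ofReal,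
      Complex.normSq_add_mul_I] at h1
    have : n ^ 2 ≠ 0 := by positivity
    exact mul_left_cancel₀ this (by rw [h1]; ring)
  have hform : ∀ X Y, tangentForm E k (S X Y) =
      (2 * n ^ 2 - k) * X ^ 2 - (2 * n ^ 2 + k) * Y ^ 2 := by
    intro X Y
    rw [tangentForm, hnorm, ← heE, ← mul_pow, heS]
    simp [pow_two]
    ring
  have hlin : ∀ X Y, (S X Y * d).re = X * d₁ - Y * d₂ := by
    intro X Y
    have : S X Y * d = (X + Y * Complex.I) * ((conj e * d) / n) := by
      rw [hS]; simp only; ring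
    rw [this, Complex.mul_re, Complex.div_ofReal_re, Complex.div_ofReal_im]
    simp [hd₁, hd₂]
  have hpair : ∀ X' Y' X Y, 2 * (S X' Y' * contactPoint E k (S X Y)).re =
      (2 * n ^ 2 - k) * (X * X') - (2 * n ^ 2 + k) * (Y * Y') := by
    intro X' Y' X Y
    have h1 : S X' Y' * contactPoint E k (S X Y) =
        (n : ℂ) ^ 2 * ((X' + Y' * Complex.I) * (X + Y * Complex.I)) -
          ((k / 2 : ℝ) : ℂ) * ((X' + Y' * Complex.I) * (X - Y * Complex.I)) := by
      have h2 : S X' Y' * contactPoint E k (S X Y) = (e * S X' Y') * (e * S X Y) -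
          ((k / 2 : ℝ) : ℂ) * (S X' Y' * conj (S X Y)) := by
        rw [contactPoint, ← heE]; ring
      have h3 : S X' Y' * conj (S X Y) = (X' + Y' * Complex.I) * (X - Y * Complex.I) := by
        rw [hS]
        simp only [map_mul, map_div₀, map_add, Complex.conj_conj, Complex.conj_ofReal,
          Complex.conj_I]
        field_simp
        linear_combination ((X' + Y' * Complex.I) * (X - Y * Complex.I)) * hee
      rw [h2, h3, heS, heS]; ring
    rw [h1]
    simp [pow_two]
    ring
  have hsurj : ∃ X' Y', s' = S X' Y' := by
    refine ⟨(e * s').re / n, (e * s').im / n, ?_⟩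
    have he0 : e ≠ 0 := by rintro rfl; simp at hn; exact hn0.ne' hn
    apply mul_left_cancel₀ he0
    rw [heS]
    push_cast
    field_simp
    exact (Complex.re_add_im _).symm
  obtain ⟨X', Y', rfl⟩ := hsurj
  obtain ⟨P, hP⟩ : ∃ P, P = 2 * n ^ 2 - k := ⟨_, rfl⟩
  obtain ⟨Q, hQ⟩ : ∃ Q, Q = 2 * n ^ 2 + k := ⟨_, rfl⟩
  have hP0 : 0 < P := by rw [hP]; linarith
  have hQ0 : 0 ≤ Q := by rw [hQ]; linarith
  simp only [← hP, ← hQ] at hform hpair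
  have hquad : ∀ X Y, P * X ^ 2 - Q * Y ^ 2 ≤ (X * d₁ - Y * d₂) ^ 2 := by
    intro X Y; rw [← hform, ← hlin]; exact hd _
  have hd₁0 : 0 < d₁ := by
    have h0 : 0 ≤ d₁ := div_nonneg hed hn0.le
    rcases h0.eq_or_lt with h | h
    · have := hquad 1 0
      rw [← h] at this
      nlinarith
    · exact h
  have hslope : P * d₂ ^ 2 ≤ Q * d₁ ^ 2 := by
    have := hquad d₂ d₁
    nlinarith
  have hsign : ∀ X Y, 0 ≤ X → Q * Y ^ 2 ≤ P * X ^ 2 → 0 ≤ X * d₁ - Y * d₂ := by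
    intro X Y hX hXY
    by_contra! hneg
    have h1 : 0 ≤ X * d₁ := by positivity
    have h2 : (X * d₁) ^ 2 < (Y * d₂) ^ 2 := pow_lt_pow_left₀ (by linarith) h1 two_ne_zero
    rcases hQ0.eq_or_lt with hq | hq
    · rw [← hq] at hslope
      have hd₂0 : d₂ = 0 := by
        have : d₂ ^ 2 ≤ 0 := by
          by_contra! hpos
          have := mul_pos hP0 hpos
          linarith
        exact pow_eq_zero_iff two_ne_zero |>.1 (le_antisymm this (sq_nonneg _))
      rw [hd₂0] at hneg
      linarith
    · have h3 : Q * (Y * d₂) ^ 2 ≤ P * (X * d₂) ^ 2 := by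
        have := mul_le_mul_of_nonneg_right hXY (sq_nonneg d₂)
        linarith
      have h4 : P * (X * d₂) ^ 2 ≤ Q * (X * d₁) ^ 2 := by
        have := mul_le_mul_of_nonneg_right hslope (sq_nonneg X)
        linarith
      have h5 := mul_lt_mul_of_pos_left h2 hq
      linarith
  have hsP : 0 < Real.sqrt P := Real.sqrt_pos.2 hP0
  -- the points of the positive branch, parametrized by `Y`
  have hpoint : ∀ Y, |ω| ≤ (Real.sqrt P * X') * Real.sqrt (1 + Q * Y ^ 2) - Q * (Y * Y') := by
    intro Y
    have hY0 : 0 ≤ 1 + Q * Y ^ 2 := by positivity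
    obtain ⟨X, hX⟩ : ∃ X, X = Real.sqrt (1 + Q * Y ^ 2) / Real.sqrt P := ⟨_, rfl⟩
    have hX0 : 0 ≤ X := by rw [hX]; positivity
    have hX2 : P * X ^ 2 = 1 + Q * Y ^ 2 := by
      rw [hX, div_pow, Real.sq_sqrt hY0, Real.sq_sqrt hP0.le, mul_div_cancel₀ _ hP0.ne']
    have hunit : tangentForm E k (S X Y) = 1 := by rw [hform, hX2]; ring
    have hpos : 0 < (S X Y * d).re := by
      have h1 := hd (S X Y)
      rw [hunit] at h1
      refine lt_of_le_of_ne (by rw [hlin]; exact hsign X Y hX0 (by linarith)) fun h0 => ?_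
      rw [← h0] at h1
      norm_num at h1
    have h2 := H _ hunit hpos
    rw [hpair] at h2
    have h3 : P * (X * X') = Real.sqrt P * X' * Real.sqrt (1 + Q * Y ^ 2) := by
      rw [hX]
      nth_rewrite 1 [← Real.mul_self_sqrt hP0.le]
      field_simp
    rwa [h3] at h2
  have hX'0 : 0 ≤ Real.sqrt P * X' := by
    have := hpoint 0
    simp only [ne_eq, OfNat.ofNat_ne_zero, not_false_eq_true, zero_pow, mul_zero, add_zero,
      Real.sqrt_one, mul_one, zero_mul, sub_zero] at this
    exact (abs_nonneg ω).trans this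
  have hbranch : ∀ t : ℝ,
      |ω| ≤ (Real.sqrt P * X') * Real.sqrt (1 + t ^ 2) - (Real.sqrt Q * Y') * t := by
    intro t
    obtain ⟨Y, hY, hYt⟩ : ∃ Y, Real.sqrt Q * Y' * t = Q * (Y * Y') ∧ Q * Y ^ 2 ≤ t ^ 2 := by
      rcases hQ0.eq_or_lt with hq | hq
      · exact ⟨0, by simp [← hq], by simp [sq_nonneg]⟩
      · have hs := Real.sqrt_pos.2 hq
        refine ⟨t / Real.sqrt Q, ?_, ?_⟩
        · nth_rewrite 2 [← Real.mul_self_sqrt hq.le]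
          field_simp
        · rw [div_pow, Real.sq_sqrt hq.le, mul_div_cancel₀ _ hq.ne']
    rw [hY]
    refine (hpoint Y).trans (sub_le_sub_right (mul_le_mul_of_nonneg_left ?_ hX'0) _)
    exact Real.sqrt_le_sqrt (by linarith)
  have hfin := sq_add_sq_le_of_forall_le (abs_nonneg ω) hbranch
  rw [sq_abs, mul_pow, mul_pow, Real.sq_sqrt hP0.le, Real.sq_sqrt hQ0] at hfin
  refine ⟨by rw [hform]; linarith, ?_⟩
  rw [hlin]
  exact hsign X' Y' (nonneg_of_mul_nonneg_right hX'0 hsP)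
    (by linarith [sq_nonneg ω])

/-! ### The numerical range as a pseudo-convex hull -/

theorem tangentForm_real_mul (E : ℂ) (k t : ℝ) (s : ℂ) :
    tangentForm E k (t * s) = t ^ 2 * tangentForm E k s := by
  have : E * ((t : ℂ) * s) ^ 2 = ((t ^ 2 : ℝ) : ℂ) * (E * s ^ 2) := by push_cast; ring
  rw [tangentForm, tangentForm, this, Complex.re_ofReal_mul, map_mul, Complex.normSq_ofReal]
  ring

theorem contactPoint_real_mul (E : ℂ) (k t : ℝ) (s : ℂ) :
    contactPoint E k (t * s) = t * contactPoint E k s := by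
  rw [contactPoint, contactPoint, map_mul, Complex.conj_ofReal]
  ring

section

variable {r m : ℕ} {α β : ℂ} {C : Matrix (Fin r) (Fin m) ℂ} {D : Matrix (Fin m) (Fin r) ℂ}
  {z : Fin m → ℂ} {h : Fin m → ℝ}

/-- A contact point with `Re (s (α - β)) > 0` is the value of a vector of positive norm. -/
theorem exists_blockValue_pos (hmr : m ≤ r) (hz : D * C = Matrix.diagonal z)
    (hh : Cᴴ * C + D * Dᴴ = Matrix.diagonal fun j => (h j : ℂ)) {j : Fin m} {s : ℂ}
    (hs : tangentForm (Delta α β (z j) / 4) (mixedCoeff α β (h j)) s = 1)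
    (hpos : 0 < (s * (α - β)).re) :
    ∃ p y, blockValue α β C D p y =
      ((α + β) / 2 + contactPoint (Delta α β (z j) / 4) (mixedCoeff α β (h j)) s, 1) := by
  have hg := gramValue_nonneg hz hh s j
  have hs' := hs
  rw [tangentForm_eq_sub_gramValue] at hs'
  have hR : 1 ≤ (s * (α - β)).re := by nlinarith
  rcases hR.eq_or_lt with hR | hR
  · -- the point is `α`, the value of a vector in the first block
    have h0 : gramValue (z j) (h j) s = 0 := by rw [← hR] at hs'; linarith
    refine ⟨Pi.single ⟨0, (Nat.zero_le _).trans_lt (j.2.trans_le hmr)⟩ 1, 0, ?_⟩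
    rw [contactPoint_eq, ← hR, add_sub_assoc, contact_term_eq_zero hz hh h0]
    have h1 : sqNorm (Pi.single (⟨0, (Nat.zero_le _).trans_lt (j.2.trans_le hmr)⟩ : Fin r) (1 : ℂ))
        = 1 := by
      rw [sqNorm, Finset.sum_eq_single ⟨0, (Nat.zero_le _).trans_lt (j.2.trans_le hmr)⟩
        (fun i _ hij => by simp [hij]) (by simp)]
      simp
    have h2 : sqNorm (0 : Fin m → ℂ) = 0 := by simp [sqNorm]
    ext1
    · simp only [blockValue, h1, h2, mulVec_zero, dotProduct_zero, star_zero, zero_dotProduct]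
      push_cast; ring
    · simp [blockValue, h1, h2]
  · have ha : 0 < (s * (α - β)).re + -1 := by linarith
    refine ⟨_, Pi.single j ((Real.sqrt (((s * (α - β)).re + -1) / 2) : ℝ) : ℂ),
      (blockValue_kernel (ω := -1) α β hz hh ha.ne' ?_).trans ?_⟩
    · intro i hi
      obtain rfl : i = j := by
        by_contra hij
        exact hi (by simp [hij])
      rw [hs]; norm_num
    · rw [Finset.sum_eq_single j (fun i _ hij => by simp [hij]) (by simp)]
      rw [Pi.single_eq_same, Complex.normSq_ofReal, Real.mul_self_sqrt (by linarith),
        mul_div_cancel₀ _ two_ne_zero, div_self ha.ne', one_smul]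
      ext1 <;> simp

/-- A contact point with `Re (s (α - β)) < 0` is the value of a vector of negative norm. -/
theorem exists_blockValue_neg (hz : D * C = Matrix.diagonal z)
    (hh : Cᴴ * C + D * Dᴴ = Matrix.diagonal fun j => (h j : ℂ)) {j : Fin m} {s : ℂ}
    (hs : tangentForm (Delta α β (z j) / 4) (mixedCoeff α β (h j)) s = 1)
    (hneg : (s * (α - β)).re < 0) :
    ∃ p y, blockValue α β C D p y =
      (-((α + β) / 2 + contactPoint (Delta α β (z j) / 4) (mixedCoeff α β (h j)) s), -1) := by
  have hR : ((((-1 : ℝ) : ℂ) * s) * (α - β)).re = -(s * (α - β)).re := by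
    rw [mul_assoc, Complex.re_ofReal_mul]; ring
  have ha : 0 < ((((-1 : ℝ) : ℂ) * s) * (α - β)).re + 1 := by rw [hR]; linarith
  refine ⟨_, Pi.single j
    ((Real.sqrt ((((((-1 : ℝ) : ℂ) * s) * (α - β)).re + 1) / 2) : ℝ) : ℂ),
    (blockValue_kernel (ω := 1) α β hz hh ha.ne' ?_).trans ?_⟩
  · intro i hi
    obtain rfl : i = j := by
      by_contra hij
      exact hi (by simp [hij])
    rw [tangentForm_real_mul, hs]; norm_num
  · rw [Finset.sum_eq_single j (fun i _ hij => by simp [hij]) (by simp)]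
    rw [Pi.single_eq_same, Complex.normSq_ofReal, Real.mul_self_sqrt (by linarith),
      mul_div_cancel₀ _ two_ne_zero, div_self ha.ne', one_smul, contactPoint_real_mul]
    ext1
    · push_cast; ring
    · rfl

/-- Values of nonzero level lie in the cone over the hull of the signed contact points: otherwise a
functional separates such a value properly from the cone; its Hermitian form is positive
semidefinite by duality, and vectors in the kernel of this form have values in the cone. -/
theorem blockValue_mem_hullCone (hm : 0 < m) (hz : D * C = Matrix.diagonal z)
    (hh : Cᴴ * C + D * Dᴴ = Matrix.diagonal fun j => (h j : ℂ))
    (hb : ∀ j, Admissible α β (z j) (h j)) {P M : Set ℂ}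
    (hP : ∀ j s, tangentForm (Delta α β (z j) / 4) (mixedCoeff α β (h j)) s = 1 →
      0 < (s * (α - β)).re →
      (α + β) / 2 + contactPoint (Delta α β (z j) / 4) (mixedCoeff α β (h j)) s ∈ P)
    (hM : ∀ j s, tangentForm (Delta α β (z j) / 4) (mixedCoeff α β (h j)) s = 1 →
      (s * (α - β)).re < 0 →
      (α + β) / 2 + contactPoint (Delta α β (z j) / 4) (mixedCoeff α β (h j)) s ∈ M)
    (hcone : ∀ g ∈ hullCone P M, ∃ p y, g = blockValue α β C D p y)
    {p : Fin r → ℂ} {y : Fin m → ℂ} (hlevel : (blockValue α β C D p y).2 ≠ 0) :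
    blockValue α β C D p y ∈ hullCone P M := by
  by_contra hv
  obtain ⟨f, hf, hfv, hproper⟩ := exists_proper_separation (K := hullCone P M) zero_mem_hullCone
    (fun _ hu _ hv => add_mem_hullCone hu hv) (fun _ ht _ hv => smul_mem_hullCone ht hv) hv
  -- line coordinates of the functional, relative to the centre `c`
  set c := (α + β) / 2 with hc
  set ω := f (c, 1) with hω
  set s' : ℂ := ⟨f (1, 0) / 2, -f (Complex.I, 0) / 2⟩ with hs'
  set R := (s' * (α - β)).re with hR
  have hfeq : ∀ v : ℂ × ℝ, f v = 2 * (s' * (v.1 - c * v.2)).re + ω * v.2 := by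
    rintro ⟨w, l⟩
    have h1 : (w, l) = (w - c * l).re • ((1 : ℂ), (0 : ℝ)) + (w - c * l).im • (Complex.I, (0 : ℝ)) +
        l • (c, (1 : ℝ)) := by
      ext1
      · simp only [Prod.smul_mk, Prod.mk_add_mk, Complex.real_smul, mul_one]
        rw [Complex.re_add_im]; ring
      · simp
    rw [h1, map_add, map_add, map_smul, map_smul, map_smul, ← hω, ← h1, Complex.mul_re]
    simp only [smul_eq_mul, hs']
    ring
  have hfval : ∀ p y, f (blockValue α β C D p y) = (R + ω) * sqNorm p + (R - ω) * sqNorm y +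
      2 * (star p ⬝ᵥ (offDiagonal C D s' *ᵥ y)).re := by
    intro p y
    rw [hfeq, functional_blockValue]
  have hdual : ∀ j, ω ^ 2 ≤ tangentForm (Delta α β (z j) / 4) (mixedCoeff α β (h j)) s' ∧
      0 ≤ R := by
    intro j
    have hnorm : 2 * ‖Delta α β (z j) / 4‖ = ‖Delta α β (z j)‖ / 2 := by
      rw [norm_div, show ‖(4 : ℂ)‖ = 4 by norm_num]; ring
    refine tangentForm_ge_of_forall_le (by rw [hnorm]; exact (hb j).1)
      (by rw [hnorm]; exact (hb j).2) (fun s => ?_) fun s hs hpos => ?_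
    · rw [tangentForm_eq_sub_gramValue]
      linarith [gramValue_nonneg hz hh s j]
    · have h1 := hf _ (mem_hullCone_of_signedHull (.pos (hP j s hs hpos)))
      have h2 := hf _ (mem_hullCone_of_signedHull (.neg (hM j (((-1 : ℝ) : ℂ) * s)
        (by rw [tangentForm_real_mul, hs]; norm_num)
        (by rw [mul_assoc, Complex.re_ofReal_mul]; linarith))))
      rw [hfeq] at h1 h2
      rw [contactPoint_real_mul] at h2
      simp only [signOf, if_true, Bool.false_eq_true, if_false, one_smul, Prod.smul_mk,
        smul_eq_mul, mul_one, Complex.ofReal_one, Complex.real_smul] at h1 h2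
      rw [show c + contactPoint (Delta α β (z j) / 4) (mixedCoeff α β (h j)) s - c =
        contactPoint (Delta α β (z j) / 4) (mixedCoeff α β (h j)) s by ring] at h1
      rw [show ((-1 : ℝ) : ℂ) * (c + ((-1 : ℝ) : ℂ) *
        contactPoint (Delta α β (z j) / 4) (mixedCoeff α β (h j)) s) - c * ((-1 : ℝ) : ℂ) =
        contactPoint (Delta α β (z j) / 4) (mixedCoeff α β (h j)) s by push_cast; ring] at h2
      exact abs_le.2 ⟨by linarith, by linarith⟩
  have hgram : ∀ j, gramValue (z j) (h j) s' ≤ (R + ω) * (R - ω) := by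
    intro j
    have := (hdual j).1
    rw [tangentForm_eq_sub_gramValue] at this
    linarith
  have hR0 : 0 ≤ R := (hdual ⟨0, hm⟩).2
  have hωR : |ω| ≤ R := by
    refine abs_le_of_sq_le_sq ?_ hR0
    have := (gramValue_nonneg hz hh s' ⟨0, hm⟩).trans (hgram ⟨0, hm⟩)
    linarith
  have ha0 : 0 ≤ R + ω := by linarith [neg_abs_le ω]
  have hb0 : 0 ≤ R - ω := by linarith [le_abs_self ω]
  rcases ha0.eq_or_lt with ha | ha
  · -- the form depends on the second block only
    have hg0 : ∀ j, gramValue (z j) (h j) s' = 0 := fun j =>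
      le_antisymm (by simpa [← ha] using hgram j) (gramValue_nonneg hz hh s' j)
    have hK : ∀ y, offDiagonal C D s' *ᵥ y = 0 := by
      intro y
      apply sqNorm_eq_zero
      rw [sqNorm_offDiagonal_mulVec hz hh]
      simp [hg0]
    have hfval' : ∀ p y, f (blockValue α β C D p y) = (R - ω) * sqNorm y := by
      intro p y
      rw [hfval, ← ha, hK]; simp
    rcases hb0.eq_or_lt with hb1 | hb1
    · rcases hproper with ⟨g, hg, hg0⟩ | hlt
      · obtain ⟨p, y, rfl⟩ := hcone g hg
        exact hg0 (by rw [hfval', ← hb1, zero_mul])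
      · rw [hfval', ← hb1, zero_mul] at hlt
        exact lt_irrefl _ hlt
    · rw [hfval'] at hfv
      have hy0 : sqNorm y = 0 := le_antisymm
        (by by_contra! hpos; linarith [mul_pos hb1 hpos]) (sqNorm_nonneg y)
      have hy := sqNorm_eq_zero hy0
      have hRpos : 0 < R := by linarith
      have hRω : ω = -R := by linarith
      obtain ⟨j, hj⟩ : ∃ j : Fin m, j = ⟨0, hm⟩ := ⟨_, rfl⟩
      have hunit : tangentForm (Delta α β (z j) / 4) (mixedCoeff α β (h j))
          (((R⁻¹ : ℝ) : ℂ) * s') = 1 := by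
        rw [tangentForm_real_mul, tangentForm_eq_sub_gramValue, hg0, sub_zero, ← hR]
        field_simp
      have hα : c + contactPoint (Delta α β (z j) / 4) (mixedCoeff α β (h j))
          (((R⁻¹ : ℝ) : ℂ) * s') = α := by
        have hRc : (R : ℂ) ≠ 0 := by exact_mod_cast hRpos.ne'
        rw [contactPoint_real_mul, contactPoint_eq, add_sub_assoc,
          contact_term_eq_zero hz hh (hg0 j), ← hR, hc]
        push_cast
        field_simp
        ring
      have hmem := hP j _ hunit
        (by rw [mul_assoc, Complex.re_ofReal_mul, ← hR]; positivity)
      rw [hα] at hmem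
      apply hv
      have h1 := smul_mem_hullCone (sqNorm_nonneg p)
        (mem_hullCone_of_signedHull (SignedHull.pos (P := P) (M := M) hmem))
      have h2 : blockValue α β C D p y = sqNorm p • (signOf true • (α, (1 : ℝ))) := by
        rw [hy]
        ext1
        · simp [blockValue, signOf, sqNorm, mul_comm]
        · simp [blockValue, signOf, sqNorm]
      rwa [h2]
  · -- complete the square in the first block
    have hsquare : (R + ω) * f (blockValue α β C D p y) =
        sqNorm (((R + ω : ℝ) : ℂ) • p + offDiagonal C D s' *ᵥ y) +
          ∑ j, ((R + ω) * (R - ω) - gramValue (z j) (h j) s') * Complex.normSq (y j) := by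
      rw [hfval, sqNorm_add, sqNorm_smul, Complex.normSq_ofReal, star_smul, smul_dotProduct,
        Complex.star_def, Complex.conj_ofReal, smul_eq_mul, Complex.re_ofReal_mul,
        sqNorm_offDiagonal_mulVec hz hh]
      simp only [sub_mul, Finset.sum_sub_distrib]
      rw [← Finset.mul_sum, ← sqNorm]
      ring
    have hterm : ∀ j ∈ Finset.univ, 0 ≤ ((R + ω) * (R - ω) - gramValue (z j) (h j) s') *
        Complex.normSq (y j) := fun j _ =>
      mul_nonneg (sub_nonneg.2 (hgram j)) (Complex.normSq_nonneg _)
    have hle : (R + ω) * f (blockValue α β C D p y) ≤ 0 := mul_nonpos_of_nonneg_of_nonpos ha0 hfv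
    rw [hsquare] at hle
    have hn0 := sqNorm_nonneg (((R + ω : ℝ) : ℂ) • p + offDiagonal C D s' *ᵥ y)
    have hsum0 := Finset.sum_nonneg hterm
    have hp := sqNorm_eq_zero (le_antisymm (by linarith) hn0)
    have hyj : ∀ j, y j ≠ 0 →
        tangentForm (Delta α β (z j) / 4) (mixedCoeff α β (h j)) s' = ω ^ 2 := by
      intro j hj
      have h1 := (Finset.sum_eq_zero_iff_of_nonneg hterm).1 (le_antisymm (by linarith) hsum0) j
        (Finset.mem_univ j)
      have h2 := (mul_eq_zero.1 h1).resolve_right (by simpa using hj)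
      rw [tangentForm_eq_sub_gramValue, ← hR]
      linarith
    have hpeq : p = ((-(R + ω)⁻¹ : ℝ) : ℂ) • (offDiagonal C D s' *ᵥ y) := by
      have hac : ((R + ω : ℝ) : ℂ) ≠ 0 := by exact_mod_cast ha.ne'
      rw [eq_neg_of_add_eq_zero_right hp, smul_neg, smul_smul]
      push_cast at hac ⊢
      rw [neg_mul, inv_mul_cancel₀ hac]
      simp
    have hval := blockValue_kernel α β hz hh ha.ne' hyj
    rw [← hR, ← hpeq, ← hc] at hval
    have hω0 : ω ≠ 0 := by
      intro h0
      apply hlevel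
      rw [hval, Prod.snd_sum]
      simp [h0]
    apply hv
    rw [hval]
    refine sum_mem_hullCone _ _ fun j _ => ?_
    by_cases hj : y j = 0
    · rw [hj]; simpa using zero_mem_hullCone
    refine smul_mem_hullCone (by have := Complex.normSq_nonneg (y j); positivity) ?_
    have hωc : (ω : ℂ) ≠ 0 := by exact_mod_cast hω0
    -- the contact point of the line with coordinates normalized to have level one
    have hunit : tangentForm (Delta α β (z j) / 4) (mixedCoeff α β (h j))
        (((-ω⁻¹ : ℝ) : ℂ) * s') = 1 := by
      rw [tangentForm_real_mul, hyj j hj]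
      field_simp
    have hvec : ((-ω * c + contactPoint (Delta α β (z j) / 4) (mixedCoeff α β (h j)) s', -ω) :
        ℂ × ℝ) = (-ω) • (c + contactPoint (Delta α β (z j) / 4) (mixedCoeff α β (h j))
          (((-ω⁻¹ : ℝ) : ℂ) * s'), (1 : ℝ)) := by
      rw [contactPoint_real_mul]
      ext1
      · rw [Prod.smul_fst, Complex.real_smul]
        push_cast
        field_simp
        ring
      · simp
    rw [hvec]
    have hRe : ((((-ω⁻¹ : ℝ) : ℂ) * s') * (α - β)).re = -ω⁻¹ * R := by
      rw [mul_assoc, Complex.re_ofReal_mul]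
    have hRpos : 0 < R := (abs_pos.2 hω0).trans_le hωR
    rcases lt_or_gt_of_ne hω0 with hneg | hpos
    · have hmem := hP j _ hunit
        (by rw [hRe]; exact mul_pos (neg_pos.2 (inv_lt_zero.2 hneg)) hRpos)
      have := smul_mem_hullCone (t := -ω) (by linarith)
        (mem_hullCone_of_signedHull (SignedHull.pos (P := P) (M := M) hmem))
      simpa [signOf] using this
    · have hmem := hM j _ hunit
        (by rw [hRe]; exact mul_neg_of_neg_of_pos (neg_lt_zero.2 (inv_pos.2 hpos)) hRpos)
      have := smul_mem_hullCone (t := ω) hpos.le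
        (mem_hullCone_of_signedHull (SignedHull.neg (P := P) (M := M) hmem))
      simpa [signOf] using this

end

/-- The Krein space numerical range is the pseudo-convex hull of the hyperbolas. -/
theorem numericalRange_blockMatrix {r m : ℕ} (hm : 0 < m) (hmr : m ≤ r) (α β : ℂ)
    (C : Matrix (Fin r) (Fin m) ℂ) (D : Matrix (Fin m) (Fin r) ℂ)
    (U : Matrix (Fin m) (Fin m) ℂ) (hU : U ∈ Matrix.unitaryGroup (Fin m) ℂ)
    (z : Fin m → ℂ) (h : Fin m → ℝ)
    (hz : Uᴴ * (D * C) * U = Matrix.diagonal z)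
    (hh : Uᴴ * (Cᴴ * C + D * Dᴴ) * U = Matrix.diagonal (fun j => (h j : ℂ)))
    (hb : ∀ j, Admissible α β (z j) (h j)) :
    (⋃ j, hyperbolaHat α β (z j) (h j)) ⊆ numericalRange (blockMatrix α β C D) ∧
      numericalRange (blockMatrix α β C D) =
        pseudoConvexHull (blockMatrix α β C D) (⋃ j, hyperbolaHat α β (z j) (h j)) := by
  set A := blockMatrix α β C D with hA
  set S := ⋃ j, hyperbolaHat α β (z j) (h j) with hS
  have hz' : (Uᴴ * D) * (C * U) = Matrix.diagonal z := by
    rw [← hz]; simp only [Matrix.mul_assoc]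
  have hh' : (C * U)ᴴ * (C * U) + (Uᴴ * D) * (Uᴴ * D)ᴴ =
      Matrix.diagonal (fun j => (h j : ℂ)) := by
    rw [← hh, conjTranspose_mul, conjTranspose_mul, conjTranspose_conjTranspose, Matrix.mul_add,
      Matrix.add_mul]
    simp only [Matrix.mul_assoc]
  have hconeiff := fun v => mem_kreinCone_blockMatrix_iff α β C D hU (v := v)
  have hPos : ∀ j s, tangentForm (Delta α β (z j) / 4) (mixedCoeff α β (h j)) s = 1 →
      0 < (s * (α - β)).re →
      (α + β) / 2 + contactPoint (Delta α β (z j) / 4) (mixedCoeff α β (h j)) s ∈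
        S ∩ rangePos A := by
    intro j s hs hpos
    refine ⟨Set.mem_iUnion.2 ⟨j, (hb j).mem_hyperbolaHat_iff.2 ⟨s, hs, rfl⟩⟩, ?_⟩
    obtain ⟨p, y, hpy⟩ := exists_blockValue_pos hmr hz' hh' hs hpos
    rw [mem_rangePos_iff, hconeiff]
    exact ⟨p, y, hpy.symm⟩
  have hNeg : ∀ j s, tangentForm (Delta α β (z j) / 4) (mixedCoeff α β (h j)) s = 1 →
      (s * (α - β)).re < 0 →
      (α + β) / 2 + contactPoint (Delta α β (z j) / 4) (mixedCoeff α β (h j)) s ∈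
        S ∩ {w' | -w' ∈ rangeNeg A} := by
    intro j s hs hneg
    refine ⟨Set.mem_iUnion.2 ⟨j, (hb j).mem_hyperbolaHat_iff.2 ⟨s, hs, rfl⟩⟩, ?_⟩
    obtain ⟨p, y, hpy⟩ := exists_blockValue_neg hz' hh' hs hneg
    rw [Set.mem_ofPred_eq, mem_rangeNeg_iff, hconeiff]
    exact ⟨p, y, hpy.symm⟩
  have hhull : ∀ (s : Bool) (w : ℂ),
      SignedHull (S ∩ rangePos A) (S ∩ {w' | -w' ∈ rangeNeg A}) s w →
      signOf s • (w, (1 : ℝ)) ∈ kreinCone A := fun s w hw =>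
    signedHull_mem_cone (fun _ hu _ hv => add_mem_kreinCone A hu hv)
      (fun _ ht _ hv => smul_mem_kreinCone A ht hv)
      (fun w hw => (mem_rangePos_iff A).1 hw.2) (fun w hw => (mem_rangeNeg_iff A).1 hw.2) hw
  have hcone : ∀ g ∈ hullCone (S ∩ rangePos A) (S ∩ {w' | -w' ∈ rangeNeg A}),
      g ∈ kreinCone A := by
    have hrays : ∀ (s : Bool), ∀ g ∈ hullRays (S ∩ rangePos A) (S ∩ {w' | -w' ∈ rangeNeg A}) s,
        g ∈ kreinCone A := by
      rintro s _ ⟨t, w, ht, rfl | hw, rfl⟩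
      · exact ⟨0, by simp [inner]⟩
      · rw [mul_smul]
        exact smul_mem_kreinCone A ht (hhull s w hw)
    rintro _ ⟨u₁, hu₁, u₂, hu₂, rfl⟩
    exact add_mem_kreinCone A (hrays _ _ hu₁) (hrays _ _ hu₂)
  constructor
  · intro w hw
    obtain ⟨j, hj⟩ := Set.mem_iUnion.1 hw
    obtain ⟨s, hs, rfl⟩ := (hb j).mem_hyperbolaHat_iff.1 hj
    have hne : (s * (α - β)).re ≠ 0 := by
      intro h0
      have h1 := hs
      rw [tangentForm_eq_sub_gramValue, h0] at h1
      linarith [gramValue_nonneg hz' hh' s j]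
    rcases lt_or_gt_of_ne hne with hneg | hpos
    · exact Or.inl (hNeg j s hs hneg).2
    · exact Or.inr (hPos j s hs hpos).2
  · ext w
    have hmem : ∀ s : Bool, signOf s • (w, (1 : ℝ)) ∈ kreinCone A →
        w ∈ pseudoConvexHull A S := by
      intro s hs
      refine ⟨s, signedHull_of_mem_hullCone ?_⟩
      obtain ⟨p, y, hpy⟩ := (hconeiff _).1 hs
      rw [hpy]
      refine blockValue_mem_hullCone hm hz' hh' hb hPos hNeg
        (fun g hg => (hconeiff g).1 (hcone g hg)) ?_
      rw [← hpy]
      cases s <;> simp [signOf]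
    constructor
    · rintro (hw | hw)
      · exact hmem false (by simpa [signOf] using (mem_rangeNeg_iff A).1 hw)
      · exact hmem true (by simpa [signOf] using (mem_rangePos_iff A).1 hw)
    · rintro ⟨s, hs⟩
      have := hhull s w hs
      cases s
      · exact Or.inl ((mem_rangeNeg_iff A).2 (by simpa [signOf] using this))
      · exact Or.inr ((mem_rangePos_iff A).2 (by simpa [signOf] using this))

end Krein

end

open Matrix in
theorem mainTheorem1 (r m : ℕ) (hm : 0 < m) (hmr : m ≤ r) (α β : ℂ) (hαβ : α ≠ β)
    (C : Matrix (Fin r) (Fin m) ℂ) (D : Matrix (Fin m) (Fin r) ℂ)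
    (hnormal : IsStarNormal (D * C))
    (hcomm : Commute (D * C) (Cᴴ * C + D * Dᴴ))
    (U : Matrix (Fin m) (Fin m) ℂ) (hU : U ∈ Matrix.unitaryGroup (Fin m) ℂ)
    (z : Fin m → ℂ) (h : Fin m → ℝ)
    (hz : Uᴴ * (D * C) * U = Matrix.diagonal z)
    (hh : Uᴴ * (Cᴴ * C + D * Dᴴ) * U = Matrix.diagonal (fun j => (h j : ℂ))) :
    (((∀ j, Krein.IsHyperbola (Krein.hyperbolaHat α β (z j) (h j))) ∧
        Krein.kippenhahnCurve (Krein.blockMatrix α β C D) =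
          (⋃ j, Krein.hyperbolaHat α β (z j) (h j)) ∪ {w | m < r ∧ w = α}) ↔
      (∀ j, ‖α - β‖ ^ 2 - ‖Krein.Delta α β (z j)‖ ≤ 2 * h j ∧
        2 * h j < ‖α - β‖ ^ 2 + ‖Krein.Delta α β (z j)‖)) ∧
    ((∀ j, ‖α - β‖ ^ 2 - ‖Krein.Delta α β (z j)‖ ≤ 2 * h j ∧
        2 * h j < ‖α - β‖ ^ 2 + ‖Krein.Delta α β (z j)‖) →
      (⋃ j, Krein.hyperbolaHat α β (z j) (h j)) ⊆
          Krein.numericalRange (Krein.blockMatrix α β C D) ∧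
      Krein.numericalRange (Krein.blockMatrix α β C D) =
          Krein.pseudoConvexHull (Krein.blockMatrix α β C D)
            (⋃ j, Krein.hyperbolaHat α β (z j) (h j)) ∧
      ∀ j, Krein.IsNondegenerateHyperbola (Krein.hyperbolaHat α β (z j) (h j)) ↔
        ‖α - β‖ ^ 2 - ‖Krein.Delta α β (z j)‖ < 2 * h j) := by
  have hadm : (∀ j, ‖α - β‖ ^ 2 - ‖Krein.Delta α β (z j)‖ ≤ 2 * h j ∧
      2 * h j < ‖α - β‖ ^ 2 + ‖Krein.Delta α β (z j)‖) ↔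
      ∀ j, Krein.Admissible α β (z j) (h j) :=
    forall_congr' fun j => Krein.admissible_iff.symm
  rw [hadm]
  refine ⟨⟨fun H j => Krein.isHyperbola_hyperbolaHat_iff.1 (H.1 j), fun hb => ⟨fun j =>
    (hb j).isHyperbola, Krein.kippenhahnCurve_blockMatrix hmr α β C D U hU z h hz hh hb⟩⟩,
    fun hb => ?_⟩
  obtain ⟨hsub, heq⟩ := Krein.numericalRange_blockMatrix hm hmr α β C D U hU z h hz hh hb
  exact ⟨hsub, heq, fun j => Krein.isNondegenerateHyperbola_hyperbolaHat_iff (hb j)⟩
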